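/- **Setting.** A conjunctive query $Q(\mathbf x_{\mathcal F})\leftarrow\bigwedge_{J\in\mathcal E}R_J(\mathbf x_J)$ is given by a finite set $\mathcal V$ of variables, a finite set $\mathcal E$ of hyperedges $J\subseteq\mathcal V$ and a set $\mathcal F$ of free variables. A variable is *isolated* if it is present in exactly one hyperedge and a *join variable* if it is present in at least two. $Q$ is *reduced* if every isolated variable is free and no hyperedge is contained in a different one. A *rooted join tree* $(\mathcal T,\chi,r)$ of $Q$ is a tree with root $r$ and bags $\chi(t)$ in one-to-one correspondence with the hyperedges, such that for every variable the nodes whose bags contain it form a non-empty connected subtree ($Q$ is *acyclic* if it has a join tree). $\mathcal I(\mathcal T)$ is the set of nodes that have a child, $\chi^{\Join}(t)$ the set of join variables in $\chi(t)$, and $\mathcal F_t$ the set of free variables occurring in bags of the subtree rooted at $t$. A database $D$ gives a finite relation $R_J$ over $\mathbf x_J$ for each $J\in\mathcal E$; $|D|=\sum_J|R_J|$, and $\mathrm{OUT}=Q(D)=\pi_{\mathcal F}\{v : v(\mathbf x_J)\in R_J \text{ for all } J\in\mathcal E\}$. For a tuple $v\in R_J$ and $S\subseteq J$, $d(v,S,R_J)$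 is the number of tuples of $R_J$ that agree with $v$ on $S$. **Yannakakis algorithm** (input $Q$, $D$, $(\mathcal T,\chi,r)$). (1) Apply a full reducer to $D$: replace every node's relation by its semijoin with each of its children, from the leaves to the root, and then every child's relation by its semijoin with its parent, from the root to the leaves. (2) Process the nodes $s$ in a leaf-to-root order (e.g. a post-order): if $s$ is a leaf, let $T_s=R_{\chi(s)}$; otherwise compute $$T_s = R_{\chi(s)}\wedge\bigwedge_{t\text{ child of }s}\pi_{\mathcal F_t\cup(\chi(s)\cap\chi(t))}T_t ,$$ joining with the children one after the other. (3) Return $\pi_{\mathcal F}(T_r)$. Running time is measured on a RAM with the uniform cost measure, in data complexity: a constant fits in one register; following or creating a list cell takes one step; copying a tuple takes one step per variable; reading or writing a cell of a memory region addressed by a tuple takes one step per variable of the tuple plus one. Relations are stored as lists of their tuples. Projections, semijoins and natural joins scan the lists and use such regions to eliminate duplicates, and to look up the tuples of the other relation by their values on the common variables. **Lemma.** Let $Q$ be a reduced acyclic CQ. There is a constant $C>0$, depending only on $Q$, such that the following holds for every rooted join tree $(\mathcal T,\chi,r)$ of $Q$, every leaf-to-root order of its nodes, every database $D$ for $Q$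 and every integer $\Delta\ge 1$. Suppose that 1. $\chi(r)$ contains at least one isolated free variable, and 2. $d(v,\chi^{\Join}(r),R_{\chi(r)})>\Delta$ for every $v\in R_{\chi(r)}$. Then the Yannakakis algorithm returns $Q(D)$, each tuple once, and, if $|D|\ge 1$, it takes at most $$C\cdot\Big(|D|+\Big(\sum_{t\in\mathcal I(\mathcal T)}|R_{\chi(t)}|\Big)\cdot\frac{|\mathrm{OUT}|}{\Delta}\Big)$$ steps. -/

import Mathlib

/-! ## Conjunctive queries, databases and query results -/

namespace OSY

/-- A conjunctive query (without self-joins) over the variables `V`: its hyperedges `J`, one atom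
`R_J(x_J)` for each of them, and its set of free (output) variables. -/
structure CQ (V : Type) where
  edges : Finset (Finset V)
  free : Finset V

namespace CQ

variable {V : Type} [DecidableEq V]

/-- The number of relations in which the variable `x` is present. -/
def occ (Q : CQ V) (x : V) : ℕ := (Q.edges.filter (fun J => x ∈ J)).card

/-- A variable is isolated if it is present in exactly one relation. -/
def IsIsolated (Q : CQ V) (x : V) : Prop := Q.occ x = 1

/-- A variable is a join variable if it is present in at least two relations. -/
def IsJoinVar (Q : CQ V) (x : V) : Prop := 2 ≤ Q.occ x

/-- `Q` is reduced: neither of the two reduction steps (delete an isolated variable that is not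
free; delete a hyperedge contained in another one) applies to it. -/
structure IsReduced (Q : CQ V) : Prop where
  isolated_free : ∀ x, Q.IsIsolated x → x ∈ Q.free
  no_containment : ∀ e ∈ Q.edges, ∀ f ∈ Q.edges, e ⊆ f → e = f

end CQ

/-- A tuple is a partial valuation of the variables; its schema is the set of the variables at
which it is defined. -/
abbrev Tup (V α : Type) : Type := V → Option α

section Tuples

variable {V α : Type} [DecidableEq V]

/-- `t` is a tuple over the schema `J`. -/
def Tup.HasSchema (t : Tup V α) (J : Finset V) : Prop := ∀ x, (t x).isSome ↔ x ∈ J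

/-- The restriction of a tuple to the variables in `X`. -/
def Tup.restrict (t : Tup V α) (X : Finset V) : Tup V α := fun x => if x ∈ X then t x else none

/-- The union of two tuples (used for tuples that agree on their common variables). -/
def Tup.merge (t u : Tup V α) : Tup V α := fun x => (t x).or (u x)

/-- The tuple over the schema `J` given by a valuation `v` of all variables. -/
def tupleOf (v : V → α) (J : Finset V) : Tup V α := fun x => if x ∈ J then some (v x) else none

end Tuples

/-- A database instance for `Q` with constants in `α`: for every hyperedge `J` a finite relation
over the schema `J`, stored as a list of its tuples in some order, each tuple once. -/
structure Database {V : Type} (Q : CQ V) (α : Type) where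
  rows : Finset V → List (Tup V α)
  nodup : ∀ J ∈ Q.edges, (rows J).Nodup
  schema : ∀ J ∈ Q.edges, ∀ t ∈ rows J, Tup.HasSchema t J

namespace Database

variable {V : Type} [DecidableEq V] {Q : CQ V} {α : Type}

/-- `|D|`, the total number of tuples. -/
def size (D : Database Q α) : ℕ := ∑ J ∈ Q.edges, (D.rows J).length

/-- The query result `Q(D)`: the restrictions to the free variables of all valuations `v` of the
variables with `v(x_J) ∈ R_J` for every hyperedge `J`. -/
def output (D : Database Q α) : Set (Tup V α) :=
  {t | ∃ v : V → α, (∀ J ∈ Q.edges, tupleOf v J ∈ D.rows J) ∧ t = tupleOf v Q.free}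

open Classical in
/-- The degree `d(v, S, R_J)`: the number of tuples of `R_J` that agree with `v` on `S`. -/
noncomputable def degree (D : Database Q α) (v : Tup V α) (S J : Finset V) : ℕ :=
  ((D.rows J).filter (fun t => decide (t.restrict S = v.restrict S))).length

end Database

/-! ## Rooted join trees -/

/-- A rooted join tree of `Q` with set of nodes `N`: a tree, a root, and a bag for every node, such
that the bags correspond one-to-one to the hyperedges of `Q` and, for every variable, the nodes
whose bags contain it form a non-empty connected subtree. -/
structure RootedJoinTree {V : Type} (Q : CQ V) (N : Type) where
  graph : SimpleGraph N
  isTree : graph.IsTree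
  root : N
  bag : N → Finset V
  bag_injective : Function.Injective bag
  mem_edges_iff : ∀ J, J ∈ Q.edges ↔ ∃ t, bag t = J
  connected : ∀ x : V, (graph.induce {t | x ∈ bag t}).Connected

namespace RootedJoinTree

variable {V : Type} [DecidableEq V] {Q : CQ V} {N : Type}

/-- `u` is a node of the subtree rooted at `s`: the path from the root to `u` goes through `s`. -/
def InSubtree (T : RootedJoinTree Q N) (s u : N) : Prop :=
  ∃ p : T.graph.Walk T.root u, p.IsPath ∧ s ∈ p.support

/-- `t` is a child of `s`. -/
def IsChild (T : RootedJoinTree Q N) (s t : N) : Prop := T.graph.Adj s t ∧ T.InSubtree s t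

/-- A node is internal if it is not a leaf, that is, if it has a child. -/
def IsInternal (T : RootedJoinTree Q N) (s : N) : Prop := ∃ t, T.IsChild s t

open Classical in
/-- `F_t`: the free variables that appear in the subtree rooted at `t`. -/
noncomputable def freeBelow (T : RootedJoinTree Q N) (t : N) : Finset V :=
  Q.free.filter (fun x => ∃ u, T.InSubtree t u ∧ x ∈ T.bag u)

open Classical in
/-- The join variables of the bag of `s`. -/
noncomputable def joinVars (T : RootedJoinTree Q N) (s : N) : Finset V :=
  (T.bag s).filter (fun x => Q.IsJoinVar x)

/-- `K` lists every node exactly once, and every node after all its children (as the post-order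
traversals do). -/
structure IsLeafToRoot (T : RootedJoinTree Q N) (K : List N) : Prop where
  nodup : K.Nodup
  mem : ∀ t, t ∈ K
  children_first : K.Pairwise (fun a b => ¬ T.IsChild a b)

end RootedJoinTree

/-! ## Step counting

Programs are written in a monad that counts elementary steps of a RAM with the uniform cost measure.
A constant fills one register, so a tuple over the schema `X` fills `|X|` registers. -/

/-- The result of a computation together with the number of elementary steps it took. -/
structure Timed (β : Type) where
  val : β
  time : ℕ

instance : Monad Timed where
  pure b := ⟨b, 0⟩
  bind m f := ⟨(f m.val).val, m.time + (f m.val).time⟩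

/-- Spend `n` elementary steps. -/
def step (n : ℕ) : Timed Unit := ⟨(), n⟩

/-- A loop over a stored list with a running state. One step is spent on each list cell, and one on
the test that detects the end of the list. -/
def loop {γ σ : Type} : List γ → σ → (γ → σ → Timed σ) → Timed σ
  | [], st, _ => do
    step 1
    return st
  | c :: l, st, body => do
    step 1
    let st' ← body c st
    loop l st' body

/-- Append a new cell to a linked list. -/
def push {γ : Type} (c : γ) (l : List γ) : Timed (List γ) := do
  step 1
  return c :: l

/-- Copy the registers of `t` that belong to the variables in `X`. -/
def copyOn {V α : Type} [DecidableEq V] (X : Finset V) (t : Tup V α) : Timed (Tup V α) := do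
  step X.card
  return t.restrict X

/-- Write the union of two tuples, which has the schema `X`. -/
def copyMerge {V α : Type} (X : Finset V) (t u : Tup V α) : Timed (Tup V α) := do
  step X.card
  return t.merge u

/-- A region of memory that is addressed by tuples over a fixed schema, i.e. by the contents of
as many registers as the schema has variables (an array of that dimension). -/
abbrev Region (V α β : Type) : Type := Tup V α → β

/-- Reserve an unused region; its cells hold the initial value `b`. -/
def newRegion {V α β : Type} (b : β) : Timed (Region V α β) := do
  step 1
  return fun _ => b

/-- Read the cell with address `k`, a tuple over the schema `X`: one step for every register of the
address, and one for the cell. -/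
def readCell {V α β : Type} (X : Finset V) (m : Region V α β) (k : Tup V α) : Timed β := do
  step (X.card + 1)
  return m k

/-- Overwrite the cell with address `k`, a tuple over the schema `X`. -/
def writeCell {V α β : Type} [Fintype V] [DecidableEq V] [DecidableEq α] (X : Finset V)
    (m : Region V α β) (k : Tup V α) (b : β) : Timed (Region V α β) := do
  step (X.card + 1)
  return Function.update m k b

/-! ## Relational operators, tuple by tuple -/

/-- A stored relation: its schema and the list of its tuples. -/
structure Stored (V α : Type) where
  schema : Finset V
  rows : List (Tup V α)

section Operators

variable {V α : Type} [Fintype V] [DecidableEq V] [DecidableEq α]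

/-- The projection `π_X A`, with elimination of duplicates. -/
def project (X : Finset V) (A : Stored V α) : Timed (Stored V α) := do
  let seen ← newRegion false
  let res ← loop A.rows (seen, ([] : List (Tup V α))) fun t st => do
    let k ← copyOn X t
    let b ← readCell X st.1 k
    if b then
      return st
    else do
      let seen' ← writeCell X st.1 k true
      let out ← push k st.2
      return (seen', out)
  return ⟨A.schema ∩ X, res.2⟩

/-- The semijoin `A ⋉ B`: the tuples of `A` that agree with some tuple of `B` on the common
variables. -/
def semijoin (A B : Stored V α) : Timed (Stored V α) := do
  let X := A.schema ∩ B.schema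
  let empty ← newRegion false
  let marks ← loop B.rows empty fun u m => do
    let k ← copyOn X u
    writeCell X m k true
  let out ← loop A.rows ([] : List (Tup V α)) fun t out => do
    let k ← copyOn X t
    let b ← readCell X marks k
    if b then push t out else return out
  return ⟨A.schema, out⟩

/-- The natural join `A ∧ B`: index the tuples of `B` by their values on the common variables, then
combine every tuple of `A` with the tuples of `B` that it finds in the index. -/
def join (A B : Stored V α) : Timed (Stored V α) := do
  let X := A.schema ∩ B.schema
  let empty ← newRegion ([] : List (Tup V α))
  let index ← loop B.rows empty fun u m => do
    let k ← copyOn X u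
    let l ← readCell X m k
    let l' ← push u l
    writeCell X m k l'
  let out ← loop A.rows ([] : List (Tup V α)) fun t out => do
    let k ← copyOn X t
    let l ← readCell X index k
    loop l out fun u out => do
      let w ← copyMerge (A.schema ∪ B.schema) t u
      push w out
  return ⟨A.schema ∪ B.schema, out⟩

end Operators

/-! ## The Yannakakis algorithm

The query, the rooted tree, the list `K` of its nodes, the bags and the sets `F_t` are fixed; only
the relations are data. A node's relation is kept in the slot of that node. -/

section Algorithm

variable {V : Type} [Fintype V] [DecidableEq V] {Q : CQ V} {N : Type} [DecidableEq N]
  {α : Type} [DecidableEq α]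

/-- Put the relation `A` into the slot of the node `s`. -/
def setSlot (R : N → Stored V α) (s : N) (A : Stored V α) : Timed (N → Stored V α) := do
  step 1
  return Function.update R s A

open Classical in
/-- The full reducer: first, from the leaves to the root, every node is semijoined with each of its
children; then, from the root to the leaves, every child is semijoined with its parent. -/
noncomputable def fullReduce (T : RootedJoinTree Q N) (K : List N) (R : N → Stored V α) :
    Timed (N → Stored V α) := do
  let R₁ ← loop K R fun s R => loop K R fun t R =>
    if T.IsChild s t then do
      let A ← semijoin (R s) (R t)
      setSlot R s A
    else return R
  loop K.reverse R₁ fun s R => loop K R fun t R =>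
    if T.IsChild s t then do
      let A ← semijoin (R t) (R s)
      setSlot R t A
    else return R

open Classical in
/-- The processing of a node `s`: join its relation with the relations
`π_{F_t ∪ (χ(s) ∩ χ(t))} T_t` of its children `t`, one after the other. For a leaf this leaves the
relation as it is. -/
noncomputable def processNode (T : RootedJoinTree Q N) (K : List N) (s : N)
    (R : N → Stored V α) : Timed (N → Stored V α) := do
  let A ← loop K (R s) fun t A =>
    if T.IsChild s t then do
      let P ← project (T.freeBelow t ∪ (T.bag s ∩ T.bag t)) (R t)
      join A P
    else return A
  setSlot R s A

/-- The Yannakakis algorithm, with the nodes processed in the order `K`. -/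
noncomputable def yannakakis (T : RootedJoinTree Q N) (K : List N) (D : Database Q α) :
    Timed (Stored V α) := do
  let R ← fullReduce T K (fun t => ⟨T.bag t, D.rows (T.bag t)⟩)
  let R' ← loop K R fun s R => processNode T K s R
  project Q.free (R' T.root)

end Algorithm

end OSY

/-! Call a tuple a solution if its restriction to every bag lies in the relation of that bag; the
query result is the projection of the solutions to the free variables (`output_eq`).

Correctness rests on gluing along tree edges (`exists_glue`): if two tuples agree on the common
variables of a bag `s` and its child `t`, then one can be used below `t` and the other elsewhere.
Hence the full reducer leaves at every node exactly the projection of the solutions to its bag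
(`fullReduce_spec`). Each later join at `s` yields the projection of the solutions to `bag s ∪ W`,
where `W` consists of the free variables below the children joined so far (`processNode_spec`). The
time is therefore linear in `|D|` plus a bound on the sizes of these projections
(`yannakakis_spec`).

For the sizes, a tuple over `bag s ∪ W` is determined by its two parts, so there are at most `|R_s|`
times as many as there are `W`-projections of solutions. The variables in `W` occur below a child,
so none of them is an isolated variable of the root bag. Take a solution and exchange its root tuple
for any of the more than `Δ` root tuples with the same join variables: this gives solutions with the
same `W`-part. Their outputs are distinct, because isolated variables are free in a reduced query.
Thus `Δ` times the number of `W`-projections is at most `|OUT|` (`mul_card_le_card_output`). At a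
leaf `W` is empty and `|D|` bounds the size. Nodes are as few as hyperedges, so the constant depends
on `Q` only. -/

namespace OSY

/-! ## Timed computations and loops -/

section TimedLemmas

variable {β γ σ : Type}

@[simp] theorem Timed.bind_val (m : Timed β) (f : β → Timed γ) :
    (m >>= f).val = (f m.val).val := rfl

@[simp] theorem Timed.bind_time (m : Timed β) (f : β → Timed γ) :
    (m >>= f).time = m.time + (f m.val).time := rfl

@[simp] theorem Timed.pure_val (b : β) : (pure b : Timed β).val = b := rfl

@[simp] theorem Timed.pure_time (b : β) : (pure b : Timed β).time = 0 := rfl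

@[simp] theorem push_val (c : γ) (l : List γ) : (push c l).val = c :: l := rfl

@[simp] theorem push_time (c : γ) (l : List γ) : (push c l).time = 1 := rfl

@[simp] theorem loop_nil_val (st : σ) (body : γ → σ → Timed σ) :
    (loop [] st body).val = st := rfl

@[simp] theorem loop_nil_time (st : σ) (body : γ → σ → Timed σ) :
    (loop [] st body).time = 1 := rfl

@[simp] theorem loop_cons_val (c : γ) (l : List γ) (st : σ) (body : γ → σ → Timed σ) :
    (loop (c :: l) st body).val = (loop l (body c st).val body).val := rfl

@[simp] theorem loop_cons_time (c : γ) (l : List γ) (st : σ) (body : γ → σ → Timed σ) :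
    (loop (c :: l) st body).time
      = 1 + ((body c st).time + (loop l (body c st).val body).time) := rfl

/-- Induction over the iterations of a loop. The invariant `P` speaks about the list cells that
have been visited, the current state, and the time spent so far. -/
theorem loop_invariant (l : List γ) (st : σ) (body : γ → σ → Timed σ)
    (P : List γ → σ → ℕ → Prop) (h0 : P [] st 0)
    (hstep : ∀ pre c post st τ, l = pre ++ c :: post → P pre st τ →
      P (pre ++ [c]) (body c st).val (τ + 1 + (body c st).time)) :
    ∃ τ, P l (loop l st body).val τ ∧ (loop l st body).time = τ + 1 := by
  -- The loop recurses on the unvisited suffix while the invariant speaks of the visited prefix, so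
  -- both are generalized.
  suffices H : ∀ (suf pre : List γ) (st : σ) (τ : ℕ), l = pre ++ suf → P pre st τ →
      ∃ τ', P l (loop suf st body).val τ' ∧ τ + (loop suf st body).time = τ' + 1 by
    simpa using H l [] st 0 rfl h0
  intro suf
  induction suf with
  | nil =>
    intro pre st τ hl hP
    refine ⟨τ, ?_, rfl⟩
    rw [List.append_nil] at hl
    rwa [hl]
  | cons c suf ih =>
    intro pre st τ hl hP
    obtain ⟨τ', h1, h2⟩ := ih (pre ++ [c]) (body c st).val _ (by simp [hl])
      (hstep pre c suf st τ hl hP)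
    refine ⟨τ', h1, ?_⟩
    rw [loop_cons_time]
    omega

/-- Induction over the iterations of a loop with a uniform bound on the time of an iteration. -/
theorem loop_invariant_le (l : List γ) (st : σ) (body : γ → σ → Timed σ)
    (P : List γ → σ → Prop) (b : ℕ) (h0 : P [] st)
    (hstep : ∀ pre c post st, l = pre ++ c :: post → P pre st →
      P (pre ++ [c]) (body c st).val ∧ (body c st).time ≤ b) :
    P l (loop l st body).val ∧ (loop l st body).time ≤ l.length * (b + 1) + 1 := by
  obtain ⟨τ, ⟨h1, h2⟩, h3⟩ := loop_invariant l st body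
    (fun pre st τ => P pre st ∧ τ ≤ pre.length * (b + 1)) ⟨h0, by simp⟩ (by
      rintro pre c post st τ hl ⟨hP, hτ⟩
      obtain ⟨h1, h2⟩ := hstep pre c post st hl hP
      refine ⟨h1, ?_⟩
      rw [List.length_append, List.length_singleton, add_mul]
      omega)
  exact ⟨h1, by omega⟩

end TimedLemmas

/-! ### Restricting and merging tuples -/

section TupleLemmas

variable {V α : Type} [DecidableEq V]

theorem Tup.restrict_apply (t : Tup V α) (X : Finset V) (x : V) :
    t.restrict X x = if x ∈ X then t x else none := rfl

theorem Tup.restrict_restrict (t : Tup V α) (X Y : Finset V) :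
    (t.restrict X).restrict Y = t.restrict (X ∩ Y) := by
  funext x
  by_cases hX : x ∈ X <;> by_cases hY : x ∈ Y <;> simp [Tup.restrict, hX, hY]

theorem Tup.restrict_restrict_of_subset (t : Tup V α) {X Y : Finset V} (h : Y ⊆ X) :
    (t.restrict X).restrict Y = t.restrict Y := by
  rw [Tup.restrict_restrict, Finset.inter_eq_right.mpr h]

theorem Tup.restrict_eq_iff (t u : Tup V α) (X : Finset V) :
    t.restrict X = u.restrict X ↔ ∀ x ∈ X, t x = u x := by
  constructor
  · intro h x hx
    simpa [Tup.restrict, hx] using congrFun h x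
  · intro h
    funext x
    by_cases hx : x ∈ X
    · simp [Tup.restrict, hx, h x hx]
    · simp [Tup.restrict, hx]

theorem Tup.merge_restrict (t : Tup V α) (X Y : Finset V) :
    (t.restrict X).merge (t.restrict Y) = t.restrict (X ∪ Y) := by
  funext x
  by_cases hX : x ∈ X <;> by_cases hY : x ∈ Y <;> simp [Tup.restrict, Tup.merge, hX, hY]

theorem Tup.HasSchema.restrict_eq {t : Tup V α} {J : Finset V} (h : t.HasSchema J) :
    t.restrict J = t := by
  funext x
  by_cases hx : x ∈ J
  · simp [Tup.restrict, hx]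
  · have h1 : t x = none := by simpa using fun h' => hx ((h x).1 h')
    rw [Tup.restrict_apply, if_neg hx, h1]

end TupleLemmas

/-! ## The relational operators -/

section OperatorLemmas

variable {V α : Type}

@[simp] theorem newRegion_val {β : Type} (b : β) :
    (newRegion b : Timed (Region V α β)).val = fun _ => b := rfl

@[simp] theorem newRegion_time {β : Type} (b : β) :
    (newRegion b : Timed (Region V α β)).time = 1 := rfl

@[simp] theorem copyOn_val [DecidableEq V] (X : Finset V) (t : Tup V α) : (copyOn X t).val = t.restrict X := rfl

@[simp] theorem copyOn_time [DecidableEq V] (X : Finset V) (t : Tup V α) : (copyOn X t).time = X.card := rfl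

@[simp] theorem copyMerge_val (X : Finset V) (t u : Tup V α) :
    (copyMerge X t u).val = t.merge u := rfl

@[simp] theorem copyMerge_time (X : Finset V) (t u : Tup V α) :
    (copyMerge X t u).time = X.card := rfl

@[simp] theorem readCell_val {β : Type} (X : Finset V) (m : Region V α β) (k : Tup V α) :
    (readCell X m k).val = m k := rfl

@[simp] theorem readCell_time {β : Type} (X : Finset V) (m : Region V α β) (k : Tup V α) :
    (readCell X m k).time = X.card + 1 := rfl

@[simp] theorem writeCell_val [Fintype V] [DecidableEq V] [DecidableEq α] {β : Type}
    (X : Finset V) (m : Region V α β) (k : Tup V α) (b : β) :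
    (writeCell X m k b).val = Function.update m k b := rfl

@[simp] theorem writeCell_time [Fintype V] [DecidableEq V] [DecidableEq α] {β : Type}
    (X : Finset V) (m : Region V α β) (k : Tup V α) (b : β) :
    (writeCell X m k b).time = X.card + 1 := rfl

/-- The time is exact and proportional to the rows produced, so that a join can charge its inner
loops to its output. -/
theorem loop_push_merge (Y : Finset V) (t : Tup V α) (l out : List (Tup V α)) :
    (loop l out fun u out => do
      let w ← copyMerge Y t u
      push w out).val = (l.map t.merge).reverse ++ out ∧
    (loop l out fun u out => do
      let w ← copyMerge Y t u
      push w out).time = l.length * (Y.card + 2) + 1 := by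
  induction l generalizing out with
  | nil => simp
  | cons c l ih =>
    obtain ⟨h1, h2⟩ := ih (t.merge c :: out)
    constructor
    · rw [loop_cons_val]
      simpa using h1
    · rw [loop_cons_time]
      simp only [Timed.bind_val, Timed.bind_time, copyMerge_val, copyMerge_time, push_val,
        push_time, List.length_cons] at h2 ⊢
      rw [h2]
      ring

variable [Fintype V] [DecidableEq V] [DecidableEq α]

/-- A bound on the number of steps that an operator spends per tuple it touches. -/
def tupleCost (V : Type) [Fintype V] : ℕ := 5 * Fintype.card V + 10

theorem project_spec (X : Finset V) (A : Stored V α) :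
    (project X A).val.schema = A.schema ∩ X ∧
    (project X A).val.rows.Nodup ∧
    (∀ k, k ∈ (project X A).val.rows ↔ ∃ t ∈ A.rows, t.restrict X = k) ∧
    (project X A).val.rows.length ≤ A.rows.length ∧
    (project X A).time ≤ tupleCost V * (A.rows.length + 1) := by
  have hX : X.card ≤ Fintype.card V := Finset.card_le_univ X
  obtain ⟨⟨h1, h2, -, h4⟩, h5⟩ := loop_invariant_le A.rows
    ((fun _ => false : Region V α Bool), ([] : List (Tup V α)))
    (fun t st => do
      let k ← copyOn X t
      let b ← readCell X st.1 k
      if b then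
        return st
      else do
        let seen' ← writeCell X st.1 k true
        let out ← push k st.2
        return (seen', out))
    (fun pre st => st.2.Nodup ∧ (∀ k, k ∈ st.2 ↔ ∃ t ∈ pre, t.restrict X = k) ∧
      (∀ k, st.1 k = true ↔ k ∈ st.2) ∧ st.2.length ≤ pre.length)
    -- Copying costs `|X|`, reading and writing a cell `|X| + 1` each, and a push `1`.
    (3 * X.card + 3) (by simp) (by
      rintro pre c post ⟨seen, out⟩ hl ⟨h1, h2, h3, h4⟩
      dsimp only at h1 h2 h3 h4
      simp only [Timed.bind_val, Timed.bind_time, copyOn_val, copyOn_time, readCell_val,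
        readCell_time]
      by_cases hb : seen (c.restrict X) = true
      · simp only [hb, if_true, Timed.pure_val, Timed.pure_time]
        refine ⟨⟨h1, fun k => ?_, h3, ?_⟩, by omega⟩
        · rw [h2 k]
          constructor
          · rintro ⟨t, ht, rfl⟩
            exact ⟨t, by simp [ht], rfl⟩
          · rintro ⟨t, ht, rfl⟩
            rw [List.mem_append, List.mem_singleton] at ht
            rcases ht with ht | rfl
            · exact ⟨t, ht, rfl⟩
            · exact (h2 _).1 ((h3 _).1 hb)
        · simp; omega
      · simp only [hb]
        have hn : c.restrict X ∉ out := fun h => hb ((h3 _).2 h)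
        refine ⟨⟨?_, fun k => ?_, fun k => ?_, ?_⟩, ?_⟩
        · simpa using ⟨hn, h1⟩
        · have := h2 k
          simp only [List.mem_append, List.mem_singleton, or_and_right, exists_or,
            exists_eq_left, ← this]
          simp [eq_comm, or_comm]
        · have := h3 k
          by_cases hk : k = c.restrict X
          · simp [hk]
          · simp [hk, this]
        · simpa using h4
        · simp; omega)
  refine ⟨rfl, h1, h2, h4, ?_⟩
  have h6 : (project X A).time ≤ 1 + (A.rows.length * (3 * X.card + 3 + 1) + 1) := by
    simpa [project] using h5
  refine h6.trans ?_
  unfold tupleCost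
  nlinarith [Nat.mul_le_mul_left A.rows.length hX]

theorem semijoin_spec (A B : Stored V α) (hA : A.rows.Nodup) :
    (semijoin A B).val.schema = A.schema ∧
    (semijoin A B).val.rows.Nodup ∧
    (∀ t, t ∈ (semijoin A B).val.rows ↔ t ∈ A.rows ∧
      ∃ u ∈ B.rows, u.restrict (A.schema ∩ B.schema) = t.restrict (A.schema ∩ B.schema)) ∧
    (semijoin A B).val.rows.length ≤ A.rows.length ∧
    (semijoin A B).time ≤ tupleCost V * (A.rows.length + B.rows.length + 1) := by
  set X := A.schema ∩ B.schema with hXdef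
  have hX : X.card ≤ Fintype.card V := Finset.card_le_univ X
  obtain ⟨h1, h2⟩ := loop_invariant_le B.rows (fun _ => false : Region V α Bool)
    (fun u m => do
      let k ← copyOn X u
      writeCell X m k true)
    (fun pre m => ∀ k, m k = true ↔ ∃ u ∈ pre, u.restrict X = k)
    (2 * X.card + 1) (by simp) (by
      intro pre c post m hl hm
      refine ⟨fun k => ?_, by simp; omega⟩
      have := hm k
      by_cases hk : c.restrict X = k
      · subst hk
        simp
      · simp [Ne.symm hk, this, or_and_right, exists_or, hk])
  generalize hmarks : loop B.rows (fun _ => false : Region V α Bool)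
    (fun u m => do
      let k ← copyOn X u
      writeCell X m k true) = marks at h1 h2
  obtain ⟨⟨h3, h4, h5⟩, h6⟩ := loop_invariant_le A.rows ([] : List (Tup V α))
    (fun t out => do
      let k ← copyOn X t
      let b ← readCell X marks.val k
      if b then push t out else return out)
    (fun pre out => out.Nodup ∧ (∀ t, t ∈ out ↔ t ∈ pre ∧ marks.val (t.restrict X) = true) ∧
      out.length ≤ pre.length)
    (2 * X.card + 2) (by simp) (by
      rintro pre c post out hl ⟨h3, h4, h5⟩
      have hc : c ∉ pre := by
        intro hc
        rw [hl] at hA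
        exact (List.nodup_append.1 hA).2.2 c hc c (by simp) rfl
      by_cases hb : marks.val (c.restrict X) = true
      · simp only [Timed.bind_val, Timed.bind_time, copyOn_val, copyOn_time, readCell_val,
          readCell_time, hb, if_true, push_val, push_time]
        refine ⟨⟨List.nodup_cons.2 ⟨fun h => hc ((h4 c).1 h).1, h3⟩, fun t => ?_, by simpa⟩,
          by omega⟩
        by_cases ht : t = c
        · simp [ht, hb]
        · simp [ht, h4 t]
      · simp only [Timed.bind_val, Timed.bind_time, copyOn_val, copyOn_time, readCell_val,
          readCell_time, hb]
        refine ⟨⟨h3, fun t => ?_, by simp; omega⟩, by simp; omega⟩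
        by_cases ht : t = c
        · simp [ht, h4 c, hb]
        · simp [ht, h4 t])
  have hval : (semijoin A B).val.rows = (loop A.rows ([] : List (Tup V α)) (fun t out => do
      let k ← copyOn X t
      let b ← readCell X marks.val k
      if b then push t out else return out)).val := by
    rw [← hmarks]; rfl
  have htime : (semijoin A B).time = 1 + (marks.time + ((loop A.rows ([] : List (Tup V α))
      (fun t out => do
        let k ← copyOn X t
        let b ← readCell X marks.val k
        if b then push t out else return out)).time + 0)) := by
    rw [← hmarks]; rfl
  rw [hval, htime]
  refine ⟨rfl, h3, fun t => ?_, h5, ?_⟩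
  · rw [h4, h1]
  · unfold tupleCost
    nlinarith [Nat.mul_le_mul_left A.rows.length hX, Nat.mul_le_mul_left B.rows.length hX]

/-- The join eliminates no duplicates, so `hinj` is what keeps its output free of them: a merged
tuple must determine the matching pair it came from. -/
theorem join_spec (A B : Stored V α) (hA : A.rows.Nodup) (hB : B.rows.Nodup)
    (hinj : ∀ t ∈ A.rows, ∀ t' ∈ A.rows, ∀ u ∈ B.rows, ∀ u' ∈ B.rows,
      u.restrict (A.schema ∩ B.schema) = t.restrict (A.schema ∩ B.schema) →
      u'.restrict (A.schema ∩ B.schema) = t'.restrict (A.schema ∩ B.schema) →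
      t.merge u = t'.merge u' → t = t' ∧ u = u') :
    (join A B).val.schema = A.schema ∪ B.schema ∧
    (join A B).val.rows.Nodup ∧
    (∀ w, w ∈ (join A B).val.rows ↔ ∃ t ∈ A.rows, ∃ u ∈ B.rows,
      u.restrict (A.schema ∩ B.schema) = t.restrict (A.schema ∩ B.schema) ∧ t.merge u = w) ∧
    (join A B).time ≤
      tupleCost V * (A.rows.length + B.rows.length + (join A B).val.rows.length + 1) := by
  set X := A.schema ∩ B.schema with hXdef
  set Y := A.schema ∪ B.schema with hYdef
  have hX : X.card ≤ Fintype.card V := Finset.card_le_univ X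
  have hY : Y.card ≤ Fintype.card V := Finset.card_le_univ Y
  obtain ⟨h1, h2⟩ := loop_invariant_le B.rows (fun _ => [] : Region V α (List (Tup V α)))
    (fun u m => do
      let k ← copyOn X u
      let l ← readCell X m k
      let l' ← push u l
      writeCell X m k l')
    (fun pre m => ∀ k, (m k).Nodup ∧ ∀ u, u ∈ m k ↔ u ∈ pre ∧ u.restrict X = k)
    (3 * X.card + 3) (by simp) (by
      intro pre c post m hl hm
      have hc : c ∉ pre := by
        intro hc
        rw [hl] at hB
        exact (List.nodup_append.1 hB).2.2 c hc c (by simp) rfl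
      refine ⟨fun k => ?_, by simp; omega⟩
      obtain ⟨hm1, hm2⟩ := hm k
      simp only [Timed.bind_val, copyOn_val, readCell_val, push_val, writeCell_val,
        Function.update_apply]
      by_cases hk : k = c.restrict X
      · subst hk
        simp only [if_true]
        refine ⟨List.nodup_cons.2 ⟨fun h => hc ((hm2 c).1 h).1, hm1⟩, fun u => ?_⟩
        by_cases hu : u = c
        · simp [hu]
        · simp [hu, hm2 u]
      · simp only [hk, if_false]
        refine ⟨hm1, fun u => ?_⟩
        rw [hm2]
        by_cases hu : u = c
        · simp [hu, Ne.symm hk]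
        · simp [hu])
  generalize hindex : loop B.rows (fun _ => [] : Region V α (List (Tup V α)))
    (fun u m => do
      let k ← copyOn X u
      let l ← readCell X m k
      let l' ← push u l
      writeCell X m k l') = index at h1 h2
  obtain ⟨τ, ⟨h3, h4, h5⟩, h6⟩ := loop_invariant A.rows ([] : List (Tup V α))
    (fun t out => do
      let k ← copyOn X t
      let l ← readCell X index.val k
      loop l out fun u out => do
        let w ← copyMerge Y t u
        push w out)
    -- An iteration has no uniform time bound, so the invariant carries the time: a fixed charge per
    -- visited row of `A`, and `|Y| + 2` per output row.
    (fun pre out τ => out.Nodup ∧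
      (∀ w, w ∈ out ↔ ∃ t ∈ pre, ∃ u ∈ B.rows, u.restrict X = t.restrict X ∧ t.merge u = w) ∧
      τ ≤ pre.length * (2 * X.card + 3) + out.length * (Y.card + 2)) (by simp) (by
      rintro pre c post out τ hl ⟨h3, h4, h5⟩
      have hc : c ∉ pre := by
        intro hc
        rw [hl] at hA
        exact (List.nodup_append.1 hA).2.2 c hc c (by simp) rfl
      have hcA : c ∈ A.rows := by simp [hl]
      have hpA : ∀ t ∈ pre, t ∈ A.rows := fun t ht => by simp [hl, ht]
      obtain ⟨e1, e2⟩ := loop_push_merge Y c (index.val (c.restrict X)) out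
      obtain ⟨i1, i2⟩ := h1 (c.restrict X)
      simp only [Timed.bind_val, Timed.bind_time, copyOn_val, copyOn_time, readCell_val,
        readCell_time] at e1 e2 ⊢
      rw [e1, e2]
      refine ⟨?_, fun w => ?_, ?_⟩
      · rw [List.nodup_append]
        refine ⟨List.nodup_reverse.2 (i1.map_on fun u hu u' hu' he => ?_), h3, ?_⟩
        · obtain ⟨a1, a2⟩ := (i2 u).1 hu
          obtain ⟨b1, b2⟩ := (i2 u').1 hu'
          exact (hinj c hcA c hcA u a1 u' b1 a2 b2 he).2
        · rintro w hw w' hw' rfl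
          rw [List.mem_reverse, List.mem_map] at hw
          obtain ⟨u, hu, rfl⟩ := hw
          obtain ⟨a1, a2⟩ := (i2 u).1 hu
          obtain ⟨t, ht, u', hu', b2, he⟩ := (h4 _).1 hw'
          have := (hinj t (hpA t ht) c hcA u' hu' u a1 b2 a2 he).1
          exact hc (this ▸ ht)
      · rw [List.mem_append, List.mem_reverse, List.mem_map, h4]
        simp only [i2, List.mem_append, List.mem_singleton, or_and_right, exists_or,
          exists_eq_left, and_assoc]
        exact or_comm
      · simp only [List.length_append, List.length_reverse, List.length_map,
          List.length_singleton]
        nlinarith)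
  have hval : (join A B).val.rows = (loop A.rows ([] : List (Tup V α))
      (fun t out => do
        let k ← copyOn X t
        let l ← readCell X index.val k
        loop l out fun u out => do
          let w ← copyMerge Y t u
          push w out)).val := by
    rw [← hindex]; rfl
  have htime : (join A B).time = 1 + (index.time + ((loop A.rows ([] : List (Tup V α))
      (fun t out => do
        let k ← copyOn X t
        let l ← readCell X index.val k
        loop l out fun u out => do
          let w ← copyMerge Y t u
          push w out)).time + 0)) := by
    rw [← hindex]; rfl
  rw [hval, htime]
  refine ⟨rfl, h3, h4, ?_⟩
  rw [h6]
  unfold tupleCost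
  nlinarith [Nat.mul_le_mul_left A.rows.length hX, Nat.mul_le_mul_left B.rows.length hX,
    Nat.mul_le_mul_left (loop A.rows ([] : List (Tup V α))
      (fun t out => do
        let k ← copyOn X t
        let l ← readCell X index.val k
        loop l out fun u out => do
          let w ← copyMerge Y t u
          push w out)).val.length hY]

end OperatorLemmas

/-! ## Rooted trees -/

namespace RootedJoinTree

open SimpleGraph

section Tree

variable {V : Type} {Q : CQ V} {N : Type} {T : RootedJoinTree Q N}

theorem isPath_unique {u v : N} {p q : T.graph.Walk u v} (hp : p.IsPath) (hq : q.IsPath) :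
    p = q :=
  (T.isTree.existsUnique_path u v).unique hp hq

theorem inSubtree_refl (s : N) : T.InSubtree s s := by
  obtain ⟨p, hp, -⟩ := T.isTree.existsUnique_path T.root s
  exact ⟨p, hp, p.end_mem_support⟩

theorem inSubtree_root (u : N) : T.InSubtree T.root u := by
  obtain ⟨p, hp, -⟩ := T.isTree.existsUnique_path T.root u
  exact ⟨p, hp, p.start_mem_support⟩

theorem InSubtree.mem_support {s u : N} (h : T.InSubtree s u) {p : T.graph.Walk T.root u}
    (hp : p.IsPath) : s ∈ p.support := by
  obtain ⟨q, hq, hs⟩ := h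
  rwa [isPath_unique hp hq]

theorem InSubtree.exists_child {s u : N} (h : T.InSubtree s u) (hne : u ≠ s) :
    ∃ t, T.IsChild s t ∧ T.InSubtree t u := by
  classical
  obtain ⟨p, hp, hs⟩ := h
  have hspec := p.take_spec hs
  generalize p.takeUntil s hs = q at hspec
  generalize p.dropUntil s hs = r at hspec
  cases r with
  | nil => exact absurd rfl hne
  | cons hadj r =>
    rename_i t
    -- Rebracketing the root path moves its first edge after `s` into the prefix, which becomes a
    -- root path to `t` through `s`.
    rw [← Walk.concat_append] at hspec
    subst hspec
    refine ⟨t, ⟨hadj, _, hp.of_append_left, ?_⟩, _, hp, ?_⟩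
    · exact q.support_subset_support_concat _ q.end_mem_support
    · exact Walk.support_subset_support_append_right _ _ r.start_mem_support

theorem IsChild.inSubtree_of_inSubtree {s t u : N} (h : T.IsChild s t) (hu : T.InSubtree t u) :
    T.InSubtree s u := by
  classical
  obtain ⟨p, hp, ht⟩ := hu
  exact ⟨p, hp, p.support_takeUntil_subset_support ht (h.2.mem_support (hp.takeUntil ht))⟩

theorem IsChild.not_inSubtree {s t : N} (h : T.IsChild s t) : ¬ T.InSubtree t s := by
  classical
  intro hs
  obtain ⟨q, hq, hsq⟩ := h.2
  exact Walk.endpoint_notMem_support_takeUntil hq hsq h.1.ne'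
    (hs.mem_support (hq.takeUntil hsq))

theorem IsChild.not_inSubtree_root {s t : N} (h : T.IsChild s t) : ¬ T.InSubtree t T.root :=
  fun ht => h.not_inSubtree (by
    have := ht.mem_support (Walk.IsPath.nil : (Walk.nil : T.graph.Walk T.root T.root).IsPath)
    rw [Walk.support_nil, List.mem_singleton] at this
    rw [this]
    exact inSubtree_root s)

theorem exists_parent {s : N} (hs : s ≠ T.root) : ∃ p, T.IsChild p s := by
  obtain ⟨p, hp, -⟩ := T.isTree.existsUnique_path T.root s
  have hn : ¬ p.Nil := Walk.not_nil_of_ne hs.symm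
  exact ⟨p.penultimate, p.adj_penultimate hn, p, hp, p.getVert_mem_support _⟩

/-- An edge that leaves the subtree of a child `t` of `s` is the edge from `t` to `s`. -/
theorem IsChild.eq_of_adj {s t a b : N} (h : T.IsChild s t) (hab : T.graph.Adj a b)
    (ha : T.InSubtree t a) (hb : ¬ T.InSubtree t b) : a = t ∧ b = s := by
  classical
  obtain ⟨p, hp, htp⟩ := ha
  -- Otherwise the root path to `a`, which passes `t`, could be prolonged to `b`, putting `b` below
  -- `t`.
  have hbp : b ∈ p.support := by
    by_contra hbp
    exact hb ⟨p.concat hab, hp.concat hbp hab, p.support_subset_support_concat _ htp⟩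
  obtain ⟨q, hq, -⟩ := T.isTree.existsUnique_path T.root b
  have htq : t ∉ q.support := fun htq => hb ⟨q, hq, htq⟩
  have haq : a ∉ q.support := by
    rw [isPath_unique hq (hp.takeUntil hbp)]
    exact Walk.endpoint_notMem_support_takeUntil hp hbp hab.ne
  -- So `b` is the last node before `a` on the root path. As `t` is on `p` but not on `q`, it must
  -- be `a`; then `b` is the parent of `t`, which is `s`.
  have hpq : p = q.concat hab.symm := isPath_unique hp (hq.concat haq hab.symm)
  have hat : a = t := by
    rw [hpq, Walk.support_concat] at htp
    simpa [htq, eq_comm] using htp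
  refine ⟨hat, ?_⟩
  subst hat
  obtain ⟨r, hr, -⟩ := T.isTree.existsUnique_path T.root s
  have har : a ∉ r.support := fun har => h.not_inSubtree ⟨r, hr, har⟩
  have hpr : p = r.concat h.1 := isPath_unique hp (hr.concat har h.1)
  rw [← q.penultimate_concat hab.symm, ← hpq, hpr, Walk.penultimate_concat]

/-- The bags inside the subtree of a child `t` of `s` share with the bags outside it only
variables that are common to the bags of `s` and `t`. -/
theorem IsChild.mem_bag_inter {s t n n' : N} (h : T.IsChild s t) (hn : T.InSubtree t n)
    (hn' : ¬ T.InSubtree t n') {x : V} (hx : x ∈ T.bag n) (hx' : x ∈ T.bag n') :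
    x ∈ T.bag s ∧ x ∈ T.bag t := by
  obtain ⟨w⟩ := (T.connected x).preconnected ⟨n, hx⟩ ⟨n', hx'⟩
  -- A walk through bags containing `x` must leave the subtree somewhere, and the only exit is the
  -- edge from `t` to `s`.
  obtain ⟨d, -, h1, h2⟩ := w.exists_boundary_dart {m | T.InSubtree t m.1} hn hn'
  obtain ⟨e1, e2⟩ := h.eq_of_adj (comap_adj.1 d.adj) h1 h2
  have h1 := d.fst.2
  have h2 := d.snd.2
  simp only [Function.Embedding.subtype_apply] at e1 e2
  rw [e1] at h1
  rw [e2] at h2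
  exact ⟨h2, h1⟩

theorem exists_mem_bag (T : RootedJoinTree Q N) (x : V) : ∃ n, x ∈ T.bag n := by
  obtain ⟨n⟩ := (T.connected x).nonempty
  exact ⟨n.1, n.2⟩

theorem IsLeafToRoot.child_mem {K : List N} (hK : T.IsLeafToRoot K) {pre post : List N} {s t : N}
    (h : K = pre ++ s :: post) (hst : T.IsChild s t) : t ∈ pre := by
  have h1 := hK.mem t
  have h2 := hK.children_first
  rw [h] at h1 h2
  rw [List.mem_append, List.mem_cons] at h1
  rcases h1 with h1 | h1 | h1
  · exact h1
  · exact absurd h1 hst.1.ne'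
  · exact absurd hst ((List.pairwise_cons.1 (List.pairwise_append.1 h2).2.1).1 t h1)

theorem IsLeafToRoot.parent_mem {K : List N} (hK : T.IsLeafToRoot K) {pre post : List N} {s t : N}
    (h : K.reverse = pre ++ t :: post) (hst : T.IsChild s t) : s ∈ pre := by
  have h1 := hK.mem s
  have h2 := hK.children_first
  rw [← List.mem_reverse, h, List.mem_append, List.mem_cons] at h1
  rw [← List.pairwise_reverse, h] at h2
  rcases h1 with h1 | h1 | h1
  · exact h1
  · exact absurd h1 hst.1.ne
  · exact absurd hst ((List.pairwise_cons.1 (List.pairwise_append.1 h2).2.1).1 s h1)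

end Tree

section Glue

variable {V : Type} [DecidableEq V] {Q : CQ V} {N : Type} {α : Type} {T : RootedJoinTree Q N}

/-- Two tuples can be glued along the edge from `s` to its child `t` if they agree on the
common variables of the two bags. -/
theorem IsChild.exists_glue {s t : N} (h : T.IsChild s t) (v w : Tup V α)
    (hvw : ∀ x ∈ T.bag s ∩ T.bag t, v x = w x) :
    ∃ g : Tup V α, (∀ n, T.InSubtree t n → ∀ x ∈ T.bag n, g x = w x) ∧
      (∀ n, ¬ T.InSubtree t n → ∀ x ∈ T.bag n, g x = v x) := by
  classical
  refine ⟨fun x => if ∃ n, T.InSubtree t n ∧ x ∈ T.bag n then w x else v x, ?_, ?_⟩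
  · intro n hn x hx
    exact if_pos ⟨n, hn, hx⟩
  · intro n hn x hx
    by_cases hex : ∃ n, T.InSubtree t n ∧ x ∈ T.bag n
    · obtain ⟨n', hn', hx'⟩ := id hex
      simp only [if_pos hex]
      -- A variable on both sides of the edge lies in both end bags, where `v` and `w` agree.
      exact (hvw x (Finset.mem_inter.2 (h.mem_bag_inter hn' hn hx' hx))).symm
    · exact if_neg hex

end Glue

end RootedJoinTree

/-! ## The full reducer -/

/-- `A` stores the restrictions of the members of `F` to the schema `S`, each of them once. -/
structure Stored.Represents {V α : Type} [DecidableEq V] (A : Stored V α) (S : Finset V)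
    (F : Set (Tup V α)) : Prop where
  schema_eq : A.schema = S
  nodup : A.rows.Nodup
  mem_iff : ∀ k, k ∈ A.rows ↔ ∃ v ∈ F, v.restrict S = k

section Reducer

variable {V : Type} {Q : CQ V} {N : Type} {α : Type}

theorem RootedJoinTree.bag_mem_edges (T : RootedJoinTree Q N) (n : N) : T.bag n ∈ Q.edges :=
  (T.mem_edges_iff _).2 ⟨n, rfl⟩

theorem Database.length_rows_le_size (D : Database Q α) {J : Finset V} (hJ : J ∈ Q.edges) :
    (D.rows J).length ≤ D.size :=
  Finset.single_le_sum (f := fun J => (D.rows J).length) (fun _ _ => Nat.zero_le _) hJ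

@[simp] theorem setSlot_val [DecidableEq N] (R : N → Stored V α) (s : N) (A : Stored V α) :
    (setSlot R s A).val = Function.update R s A := rfl

@[simp] theorem setSlot_time [DecidableEq N] (R : N → Stored V α) (s : N) (A : Stored V α) :
    (setSlot R s A).time = 1 := rfl

variable [DecidableEq V]

/-- The tuples whose restriction to every bag belongs to the relation of that bag. -/
def RootedJoinTree.solutions (T : RootedJoinTree Q N) (D : Database Q α) : Set (Tup V α) :=
  {v | ∀ n, v.restrict (T.bag n) ∈ D.rows (T.bag n)}

/-- The tuple `u` extends to a solution of the subquery given by the subtree of `s`. -/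
def RootedJoinTree.ExtendsBelow (T : RootedJoinTree Q N) (D : Database Q α) (s : N)
    (u : Tup V α) : Prop :=
  ∃ v : Tup V α, v.restrict (T.bag s) = u ∧
    ∀ n, T.InSubtree s n → v.restrict (T.bag n) ∈ D.rows (T.bag n)

/-- The relations `R` arise from `D` by deleting dangling tuples. -/
structure RootedJoinTree.IsReduction (T : RootedJoinTree Q N) (D : Database Q α)
    (R : N → Stored V α) : Prop where
  schema_eq : ∀ n, (R n).schema = T.bag n
  nodup : ∀ n, (R n).rows.Nodup
  subset : ∀ n, (R n).rows ⊆ D.rows (T.bag n)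
  restrict_mem : ∀ n, ∀ v ∈ T.solutions D, v.restrict (T.bag n) ∈ (R n).rows

variable {T : RootedJoinTree Q N} {D : Database Q α}

theorem RootedJoinTree.IsReduction.length_le {R : N → Stored V α} (h : T.IsReduction D R) (n : N) :
    (R n).rows.length ≤ (D.rows (T.bag n)).length :=
  ((h.nodup n).subperm (h.subset n)).length_le

theorem RootedJoinTree.IsReduction.length_le_size {R : N → Stored V α} (h : T.IsReduction D R)
    (n : N) : (R n).rows.length ≤ D.size :=
  (h.length_le n).trans (D.length_rows_le_size (T.bag_mem_edges n))

theorem RootedJoinTree.isReduction_initial (T : RootedJoinTree Q N) (D : Database Q α) :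
    T.IsReduction D (fun t => ⟨T.bag t, D.rows (T.bag t)⟩) where
  schema_eq _ := rfl
  nodup n := D.nodup _ (T.bag_mem_edges n)
  subset _ := fun _ h => h
  restrict_mem n _ hv := hv n

variable [Fintype V] [DecidableEq α]

theorem RootedJoinTree.IsReduction.semijoin_time_le {R : N → Stored V α} (h : T.IsReduction D R)
    (s t : N) : (OSY.semijoin (R s) (R t)).time ≤ tupleCost V * (2 * D.size + 1) := by
  obtain ⟨-, -, -, -, h5⟩ := semijoin_spec (R s) (R t) (h.nodup s)
  refine h5.trans (Nat.mul_le_mul_left _ ?_)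
  have := h.length_le_size s
  have := h.length_le_size t
  omega

variable [DecidableEq N]

/-- A semijoin never deletes the projection of a solution, since the projection of the same solution
to the other bag is a partner for it. -/
theorem RootedJoinTree.IsReduction.semijoin {R : N → Stored V α} (h : T.IsReduction D R)
    (s t : N) : T.IsReduction D (Function.update R s (OSY.semijoin (R s) (R t)).val) := by
  obtain ⟨h1, h2, h3, -, -⟩ := semijoin_spec (R s) (R t) (h.nodup s)
  refine ⟨fun n => ?_, fun n => ?_, fun n => ?_, fun n v hv => ?_⟩ <;>
    by_cases hn : n = s
  · subst hn; rw [Function.update_self, h1, h.schema_eq]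
  · rw [Function.update_of_ne hn, h.schema_eq]
  · subst hn; rwa [Function.update_self]
  · rw [Function.update_of_ne hn]; exact h.nodup n
  · subst hn
    rw [Function.update_self]
    exact fun u hu => h.subset n ((h3 u).1 hu).1
  · rw [Function.update_of_ne hn]; exact h.subset n
  · subst hn
    rw [Function.update_self, h3, h.schema_eq, h.schema_eq]
    refine ⟨h.restrict_mem n v hv, _, h.restrict_mem t v hv, ?_⟩
    rw [Tup.restrict_restrict_of_subset _ Finset.inter_subset_left,
      Tup.restrict_restrict_of_subset _ Finset.inter_subset_right]
  · rw [Function.update_of_ne hn]; exact h.restrict_mem n v hv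

theorem RootedJoinTree.IsReduction.mem_of_mem_update {R : N → Stored V α}
    (h : T.IsReduction D R) {s t n : N} {u : Tup V α}
    (hu : u ∈ (Function.update R s (OSY.semijoin (R s) (R t)).val n).rows) :
    u ∈ (R n).rows := by
  by_cases hn : n = s
  · subst hn
    rw [Function.update_self] at hu
    exact (((semijoin_spec (R n) (R t) (h.nodup n)).2.2.1 u).1 hu).1
  · rwa [Function.update_of_ne hn] at hu

theorem RootedJoinTree.IsReduction.exists_of_mem_update {R : N → Stored V α}
    (h : T.IsReduction D R) {s t : N} {u : Tup V α}
    (hu : u ∈ (Function.update R s (OSY.semijoin (R s) (R t)).val s).rows) :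
    ∃ w ∈ (R t).rows, ∀ x ∈ T.bag s ∩ T.bag t, w x = u x := by
  rw [Function.update_self] at hu
  obtain ⟨w, hw, he⟩ := (((semijoin_spec (R s) (R t) (h.nodup s)).2.2.1 u).1 hu).2
  rw [h.schema_eq, h.schema_eq, Tup.restrict_eq_iff] at he
  exact ⟨w, hw, he⟩

variable {K : List N}

open Classical in
-- While the children are visited, each surviving row of `s` extends to a tuple that is correct
-- below all children visited so far. A row that survives the semijoin with `t` matches a row of
-- `t`, whose own extension below `t` is then glued in.
theorem bottomUp_node_spec (hK : T.IsLeafToRoot K) {pre post : List N} {s : N}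
    (hs : K = pre ++ s :: post) {R : N → Stored V α} (hR : T.IsReduction D R)
    (hpre : ∀ t ∈ pre, ∀ u ∈ (R t).rows, T.ExtendsBelow D t u) :
    let L := loop K R fun t R =>
      if T.IsChild s t then do
        let A ← semijoin (R s) (R t)
        setSlot R s A
      else return R
    (T.IsReduction D L.val ∧ ∀ t ∈ pre ++ [s], ∀ u ∈ (L.val t).rows, T.ExtendsBelow D t u) ∧
      L.time ≤ K.length * (tupleCost V * (2 * D.size + 1) + 2) + 1 := by
  intro L
  obtain ⟨⟨h1, h2, h3⟩, h4⟩ := loop_invariant_le K R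
    (fun t R =>
      if T.IsChild s t then do
        let A ← semijoin (R s) (R t)
        setSlot R s A
      else return R)
    (fun pre' R => T.IsReduction D R ∧
      (∀ t ∈ pre, ∀ u ∈ (R t).rows, T.ExtendsBelow D t u) ∧
      ∀ u ∈ (R s).rows, ∃ v : Tup V α, v.restrict (T.bag s) = u ∧
        ∀ t ∈ pre', T.IsChild s t → ∀ n, T.InSubtree t n →
          v.restrict (T.bag n) ∈ D.rows (T.bag n))
    (tupleCost V * (2 * D.size + 1) + 1)
    ⟨hR, hpre, fun u hu => ⟨u, (D.schema _ (T.bag_mem_edges s) u (hR.subset s hu)).restrict_eq,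
      by simp⟩⟩ (by
      rintro pre' t post' R hl ⟨hR, hpre, hR'⟩
      by_cases hst : T.IsChild s t
      · simp only [hst, if_true, Timed.bind_val, Timed.bind_time, setSlot_val, setSlot_time]
        refine ⟨⟨hR.semijoin s t, fun t' ht' u hu => hpre t' ht' u (hR.mem_of_mem_update hu),
          fun u hu => ?_⟩, Nat.add_le_add_right (hR.semijoin_time_le s t) 1⟩
        obtain ⟨v, rfl, hv⟩ := hR' u (hR.mem_of_mem_update hu)
        obtain ⟨u', hu', hvu⟩ := hR.exists_of_mem_update hu
        obtain ⟨w, rfl, hw⟩ := hpre t (hK.child_mem hs hst) u' hu'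
        obtain ⟨g, hg1, hg2⟩ := hst.exists_glue v w (fun x hx => by
          have := hvu x hx
          rw [Finset.mem_inter] at hx
          simpa [Tup.restrict_apply, hx.1, hx.2] using this.symm)
        refine ⟨g, (Tup.restrict_eq_iff _ _ _).2 (hg2 s hst.not_inSubtree), ?_⟩
        intro t' ht' hst' n hn
        -- The split is on whether `n` lies below `t`, not on which child is meant, so disjointness
        -- of the children's subtrees is not needed.
        by_cases hnt : T.InSubtree t n
        · rw [(Tup.restrict_eq_iff _ _ _).2 (hg1 n hnt)]
          exact hw n hnt
        · rw [(Tup.restrict_eq_iff _ _ _).2 (hg2 n hnt)]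
          rw [List.mem_append, List.mem_singleton] at ht'
          rcases ht' with ht' | rfl
          · exact hv t' ht' hst' n hn
          · exact absurd hn hnt
      · simp only [hst, if_false, Timed.pure_val, Timed.pure_time]
        refine ⟨⟨hR, hpre, fun u hu => ?_⟩, Nat.zero_le _⟩
        obtain ⟨v, hv1, hv2⟩ := hR' u hu
        refine ⟨v, hv1, fun t' ht' hst' => ?_⟩
        rw [List.mem_append, List.mem_singleton] at ht'
        rcases ht' with ht' | rfl
        · exact hv2 t' ht' hst'
        · exact absurd hst' hst)
  refine ⟨⟨h1, fun t ht u hu => ?_⟩, h4⟩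
  rw [List.mem_append, List.mem_singleton] at ht
  rcases ht with ht | rfl
  · exact h2 t ht u hu
  · obtain ⟨v, rfl, hv⟩ := h3 u hu
    refine ⟨v, rfl, fun n hn => ?_⟩
    by_cases hnt : n = t
    · subst hnt
      exact h1.subset n hu
    · obtain ⟨c, hc, hcn⟩ := hn.exists_child hnt
      exact hv c (hK.mem c) hc n hcn

open Classical in
-- Every row of `s` already comes from a solution. A surviving row of a child `t` extends below `t`
-- and matches such a row, so gluing the extension into that solution yields a solution through the
-- child's row.
theorem topDown_node_spec (hK : T.IsLeafToRoot K) {pre post : List N} {s : N}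
    (hs : K.reverse = pre ++ s :: post) {R : N → Stored V α} (hR : T.IsReduction D R)
    (hext : ∀ n, ∀ u ∈ (R n).rows, T.ExtendsBelow D n u)
    (hpre : ∀ n, (n = T.root ∨ ∃ p ∈ pre, T.IsChild p n) → ∀ u ∈ (R n).rows,
      ∃ v ∈ T.solutions D, v.restrict (T.bag n) = u) :
    let L := loop K R fun t R =>
      if T.IsChild s t then do
        let A ← semijoin (R t) (R s)
        setSlot R t A
      else return R
    (T.IsReduction D L.val ∧ (∀ n, ∀ u ∈ (L.val n).rows, T.ExtendsBelow D n u) ∧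
      (∀ n, (n = T.root ∨ ∃ p ∈ pre ++ [s], T.IsChild p n) → ∀ u ∈ (L.val n).rows,
        ∃ v ∈ T.solutions D, v.restrict (T.bag n) = u)) ∧
      L.time ≤ K.length * (tupleCost V * (2 * D.size + 1) + 2) + 1 := by
  intro L
  -- In the reversed order the parent of `s` has been processed before `s`, so `hpre` applies to
  -- `s`.
  have hs' : s = T.root ∨ ∃ p ∈ pre, T.IsChild p s := by
    by_cases hr : s = T.root
    · exact Or.inl hr
    · obtain ⟨p, hp⟩ := T.exists_parent hr
      exact Or.inr ⟨p, hK.parent_mem hs hp, hp⟩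
  obtain ⟨⟨h1, h2, h3, h3'⟩, h4⟩ := loop_invariant_le K R
    (fun t R =>
      if T.IsChild s t then do
        let A ← semijoin (R t) (R s)
        setSlot R t A
      else return R)
    (fun pre' R => T.IsReduction D R ∧ (∀ n, ∀ u ∈ (R n).rows, T.ExtendsBelow D n u) ∧
      (∀ n, (n = T.root ∨ ∃ p ∈ pre, T.IsChild p n) → ∀ u ∈ (R n).rows,
        ∃ v ∈ T.solutions D, v.restrict (T.bag n) = u) ∧
      ∀ n ∈ pre', T.IsChild s n → ∀ u ∈ (R n).rows,
        ∃ v ∈ T.solutions D, v.restrict (T.bag n) = u)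
    (tupleCost V * (2 * D.size + 1) + 1)
    ⟨hR, hext, hpre, by simp⟩ (by
      rintro pre' t post' R hl ⟨hR, hext, hpre, hpre'⟩
      by_cases hst : T.IsChild s t
      · simp only [hst, if_true, Timed.bind_val, Timed.bind_time, setSlot_val, setSlot_time]
        refine ⟨⟨hR.semijoin t s, fun n u hu => hext n u (hR.mem_of_mem_update hu),
          fun n hn u hu => hpre n hn u (hR.mem_of_mem_update hu), fun n hn hsn u hu => ?_⟩,
          Nat.add_le_add_right (hR.semijoin_time_le t s) 1⟩
        rw [List.mem_append, List.mem_singleton] at hn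
        rcases hn with hn | rfl
        · exact hpre' n hn hsn u (hR.mem_of_mem_update hu)
        obtain ⟨w, rfl, hw⟩ := hext n u (hR.mem_of_mem_update hu)
        obtain ⟨u', hu', hvu⟩ := hR.exists_of_mem_update hu
        obtain ⟨v, hv, rfl⟩ := hpre s hs' u' hu'
        obtain ⟨g, hg1, hg2⟩ := hst.exists_glue v w (fun x hx => by
          have := hvu x (by rwa [Finset.inter_comm])
          rw [Finset.mem_inter] at hx
          simpa [Tup.restrict_apply, hx.1, hx.2] using this)
        refine ⟨g, fun m => ?_,
          (Tup.restrict_eq_iff _ _ _).2 (hg1 n (RootedJoinTree.inSubtree_refl n))⟩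
        by_cases hm : T.InSubtree n m
        · rw [(Tup.restrict_eq_iff _ _ _).2 (hg1 m hm)]
          exact hw m hm
        · rw [(Tup.restrict_eq_iff _ _ _).2 (hg2 m hm)]
          exact hv m
      · simp only [hst, if_false, Timed.pure_val, Timed.pure_time]
        refine ⟨⟨hR, hext, hpre, fun n hn hsn => ?_⟩, Nat.zero_le _⟩
        rw [List.mem_append, List.mem_singleton] at hn
        rcases hn with hn | rfl
        · exact hpre' n hn hsn
        · exact absurd hsn hst)
  refine ⟨⟨h1, h2, ?_⟩, h4⟩
  rintro n (hn | ⟨p, hp, hpn⟩)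
  · exact h3 n (Or.inl hn)
  · rw [List.mem_append, List.mem_singleton] at hp
    rcases hp with hp | rfl
    · exact h3 n (Or.inr ⟨p, hp, hpn⟩)
    · exact h3' n (hK.mem n) hpn

/-- A bound on the time of the full reducer. -/
def reducerCost (V : Type) [Fintype V] (k d : ℕ) : ℕ :=
  2 * (k * (k * (tupleCost V * (2 * d + 1) + 2) + 2) + 1)

theorem fullReduce_spec (hK : T.IsLeafToRoot K) :
    let L := fullReduce T K (fun t => (⟨T.bag t, D.rows (T.bag t)⟩ : Stored V α))
    (∀ n, (L.val n).Represents (T.bag n) (T.solutions D)) ∧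
      L.time ≤ reducerCost V K.length D.size := by
  classical
  intro L
  obtain ⟨⟨h1, h2⟩, h3⟩ := loop_invariant_le K
    (fun t => (⟨T.bag t, D.rows (T.bag t)⟩ : Stored V α)) _
    (fun pre R => T.IsReduction D R ∧ ∀ t ∈ pre, ∀ u ∈ (R t).rows, T.ExtendsBelow D t u)
    (K.length * (tupleCost V * (2 * D.size + 1) + 2) + 1)
    ⟨T.isReduction_initial D, by simp⟩
    (fun pre s post R hs h => bottomUp_node_spec hK hs h.1 h.2)
  obtain ⟨⟨h4, h5, h6⟩, h7⟩ := loop_invariant_le K.reverse _ _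
    (fun pre R => T.IsReduction D R ∧ (∀ n, ∀ u ∈ (R n).rows, T.ExtendsBelow D n u) ∧
      (∀ n, (n = T.root ∨ ∃ p ∈ pre, T.IsChild p n) → ∀ u ∈ (R n).rows,
        ∃ v ∈ T.solutions D, v.restrict (T.bag n) = u))
    (K.length * (tupleCost V * (2 * D.size + 1) + 2) + 1)
    ⟨h1, fun n => h2 n (hK.mem n), by
      rintro n (rfl | ⟨p, hp, -⟩) u hu
      -- The subtree of the root is the whole tree, so the bottom-up pass alone already makes the
      -- root's rows extend to solutions.
      · obtain ⟨v, rfl, hv⟩ := h2 _ (hK.mem _) u hu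
        exact ⟨v, fun m => hv m (RootedJoinTree.inSubtree_root m), rfl⟩
      · simp at hp⟩
    (fun pre s post R hs h => topDown_node_spec hK hs h.1 h.2.1 h.2.2)
  refine ⟨fun n => ⟨h4.schema_eq n, h4.nodup n, fun u => ⟨fun hu => h6 n ?_ u hu, ?_⟩⟩, ?_⟩
  · by_cases hr : n = T.root
    · exact Or.inl hr
    · obtain ⟨p, hp⟩ := RootedJoinTree.exists_parent hr
      exact Or.inr ⟨p, List.mem_reverse.2 (hK.mem p), hp⟩
  · rintro ⟨v, hv, rfl⟩
    exact h4.restrict_mem n v hv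
  · refine (Nat.add_le_add h3 h7).trans (le_of_eq ?_)
    rw [List.length_reverse, reducerCost]
    ring

end Reducer

/-! ## The bottom-up joins -/

section Represents

variable {V α : Type} [Fintype V] [DecidableEq V] [DecidableEq α]

theorem Stored.Represents.project {A : Stored V α} {S X : Finset V} {F : Set (Tup V α)}
    (hA : A.Represents S F) (hX : X ⊆ S) :
    (OSY.project X A).val.Represents X F ∧
      (OSY.project X A).val.rows.length ≤ A.rows.length ∧
      (OSY.project X A).time ≤ tupleCost V * (A.rows.length + 1) := by
  obtain ⟨h1, h2, h3, h4, h5⟩ := project_spec X A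
  refine ⟨⟨?_, h2, fun k => ?_⟩, h4, h5⟩
  · rw [h1, hA.schema_eq, Finset.inter_eq_right.mpr hX]
  · rw [h3]
    constructor
    · rintro ⟨t, ht, rfl⟩
      obtain ⟨v, hv, rfl⟩ := (hA.mem_iff t).1 ht
      exact ⟨v, hv, (Tup.restrict_restrict_of_subset v hX).symm⟩
    · rintro ⟨v, hv, rfl⟩
      exact ⟨v.restrict S, (hA.mem_iff _).2 ⟨v, hv, rfl⟩, Tup.restrict_restrict_of_subset v hX⟩

/-- The join of two projections of `F` is a projection of `F`, if members of `F` that agree on the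
common variables can be glued. -/
theorem Stored.Represents.join {A B : Stored V α} {S S' : Finset V} {F : Set (Tup V α)}
    (hA : A.Represents S F) (hB : B.Represents S' F)
    (hglue : ∀ v ∈ F, ∀ w ∈ F, (∀ x ∈ S ∩ S', w x = v x) →
      ∃ g ∈ F, (∀ x ∈ S, g x = v x) ∧ ∀ x ∈ S', g x = w x) :
    (OSY.join A B).val.Represents (S ∪ S') F ∧
      (OSY.join A B).time ≤
        tupleCost V * (A.rows.length + B.rows.length + (OSY.join A B).val.rows.length + 1) := by
  -- Matching rows are two restrictions of one member `g` of `F`, so their merge is `g` on `S ∪ S'`.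
  -- This gives both the membership claim and the injectivity that `join_spec` requires.
  have key : ∀ t ∈ A.rows, ∀ u ∈ B.rows,
      u.restrict (A.schema ∩ B.schema) = t.restrict (A.schema ∩ B.schema) →
      ∃ g ∈ F, t = g.restrict S ∧ u = g.restrict S' := by
    intro t ht u hu he
    obtain ⟨v, hv, rfl⟩ := (hA.mem_iff t).1 ht
    obtain ⟨w, hw, rfl⟩ := (hB.mem_iff u).1 hu
    rw [hA.schema_eq, hB.schema_eq, Tup.restrict_restrict_of_subset _ Finset.inter_subset_right,
      Tup.restrict_restrict_of_subset _ Finset.inter_subset_left, Tup.restrict_eq_iff] at he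
    obtain ⟨g, hg, h1, h2⟩ := hglue v hv w hw he
    exact ⟨g, hg, ((Tup.restrict_eq_iff _ _ _).2 h1).symm, ((Tup.restrict_eq_iff _ _ _).2 h2).symm⟩
  obtain ⟨h1, h2, h3, h4⟩ := join_spec A B hA.nodup hB.nodup (by
    intro t ht t' ht' u hu u' hu' he he' hm
    obtain ⟨g, hg, rfl, rfl⟩ := key t ht u hu he
    obtain ⟨g', hg', rfl, rfl⟩ := key t' ht' u' hu' he'
    rw [Tup.merge_restrict, Tup.merge_restrict, Tup.restrict_eq_iff] at hm
    rw [Tup.restrict_eq_iff, Tup.restrict_eq_iff]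
    exact ⟨fun x hx => hm x (Finset.mem_union_left _ hx),
      fun x hx => hm x (Finset.mem_union_right _ hx)⟩)
  refine ⟨⟨?_, h2, fun k => ?_⟩, h4⟩
  · rw [h1, hA.schema_eq, hB.schema_eq]
  · rw [h3]
    constructor
    · rintro ⟨t, ht, u, hu, he, rfl⟩
      obtain ⟨g, hg, rfl, rfl⟩ := key t ht u hu he
      exact ⟨g, hg, (Tup.merge_restrict _ _ _).symm⟩
    · rintro ⟨v, hv, rfl⟩
      refine ⟨_, (hA.mem_iff _).2 ⟨v, hv, rfl⟩, _, (hB.mem_iff _).2 ⟨v, hv, rfl⟩, ?_,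
        Tup.merge_restrict _ _ _⟩
      rw [hA.schema_eq, hB.schema_eq, Tup.restrict_restrict_of_subset _ Finset.inter_subset_right,
        Tup.restrict_restrict_of_subset _ Finset.inter_subset_left]

end Represents

/-! ### Correctness and time of the joins, given a bound `M` on intermediate results -/

section Processing

variable {V : Type} {Q : CQ V} {N : Type} {α : Type} {T : RootedJoinTree Q N}
  {D : Database Q α}

theorem RootedJoinTree.mem_freeBelow {t : N} {x : V} :
    x ∈ T.freeBelow t ↔ x ∈ Q.free ∧ ∃ u, T.InSubtree t u ∧ x ∈ T.bag u := by
  simp [RootedJoinTree.freeBelow]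

variable [DecidableEq V]

open Classical in
/-- The free variables that appear below `s` in the subtrees of the children that belong to `L`. -/
noncomputable def RootedJoinTree.freeOfChildren (T : RootedJoinTree Q N) (s : N) (L : List N) :
    Finset V :=
  Q.free.filter (fun x => ∃ t ∈ L, T.IsChild s t ∧ x ∈ T.freeBelow t)

theorem RootedJoinTree.mem_freeOfChildren {s : N} {L : List N} {x : V} :
    x ∈ T.freeOfChildren s L ↔ ∃ t ∈ L, T.IsChild s t ∧ x ∈ T.freeBelow t := by
  simp only [RootedJoinTree.freeOfChildren, Finset.mem_filter, and_iff_right_iff_imp]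
  rintro ⟨t, -, -, h⟩
  exact (RootedJoinTree.mem_freeBelow.1 h).1

theorem RootedJoinTree.freeOfChildren_subset (s : N) (L : List N) :
    T.freeOfChildren s L ⊆ Q.free := by
  classical
  exact Finset.filter_subset _ _

theorem RootedJoinTree.freeOfChildren_nil (s : N) : T.freeOfChildren s [] = ∅ := by
  ext x
  simp [RootedJoinTree.mem_freeOfChildren]

theorem RootedJoinTree.bag_union_freeOfChildren {K : List N} (hK : ∀ t, t ∈ K) (s : N) :
    T.bag s ∪ T.freeOfChildren s K = T.bag s ∪ T.freeBelow s := by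
  ext x
  simp only [Finset.mem_union, RootedJoinTree.mem_freeOfChildren, RootedJoinTree.mem_freeBelow]
  refine or_congr_right' fun hx => ?_
  constructor
  · rintro ⟨t, -, hst, hf, u, hu, hxu⟩
    exact ⟨hf, u, hst.inSubtree_of_inSubtree hu, hxu⟩
  · rintro ⟨hf, u, hu, hxu⟩
    -- A variable outside the bag of `s` cannot be found at `s` itself, so it is found below a
    -- child.
    obtain ⟨t, hst, htu⟩ := hu.exists_child (by rintro rfl; exact hx hxu)
    exact ⟨t, hK t, hst, hf, u, htu, hxu⟩

/-- The inclusion `W ⊆ Q.free` is essential: a variable of `W` that occurs below `t` is free, hence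
in `freeBelow t`, where agreement is assumed. Any other variable of `W` is left untouched by the
gluing. -/
theorem RootedJoinTree.IsChild.glue_solutions {s t : N} (h : T.IsChild s t) {W : Finset V}
    (hW : W ⊆ Q.free) {v w : Tup V α} (hv : v ∈ T.solutions D) (hw : w ∈ T.solutions D)
    (hvw : ∀ x ∈ (T.bag s ∪ W) ∩ (T.freeBelow t ∪ (T.bag s ∩ T.bag t)), w x = v x) :
    ∃ g ∈ T.solutions D, (∀ x ∈ T.bag s ∪ W, g x = v x) ∧
      ∀ x ∈ T.freeBelow t ∪ (T.bag s ∩ T.bag t), g x = w x := by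
  obtain ⟨g, hg1, hg2⟩ := h.exists_glue v w (fun x hx => (hvw x (by
    rw [Finset.mem_inter] at hx
    simp [hx.1, hx.2])).symm)
  have hgw : ∀ x ∈ T.freeBelow t ∪ (T.bag s ∩ T.bag t), g x = w x := by
    intro x hx
    rw [Finset.mem_union, RootedJoinTree.mem_freeBelow, Finset.mem_inter] at hx
    rcases hx with ⟨-, n, hn, hxn⟩ | ⟨-, hx⟩
    · exact hg1 n hn x hxn
    · exact hg1 t (RootedJoinTree.inSubtree_refl t) x hx
  refine ⟨g, fun n => ?_, fun x hx => ?_, hgw⟩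
  · by_cases hn : T.InSubtree t n
    · rw [(Tup.restrict_eq_iff _ _ _).2 (hg1 n hn)]
      exact hw n
    · rw [(Tup.restrict_eq_iff _ _ _).2 (hg2 n hn)]
      exact hv n
  · by_cases hxt : x ∈ T.freeBelow t ∪ (T.bag s ∩ T.bag t)
    · rw [hgw x hxt]
      exact hvw x (Finset.mem_inter.2 ⟨hx, hxt⟩)
    · rw [Finset.mem_union] at hx
      rcases hx with hx | hx
      · exact hg2 s h.not_inSubtree x hx
      · obtain ⟨n, hn⟩ := T.exists_mem_bag x
        refine hg2 n (fun hnt => hxt ?_) x hn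
        exact Finset.mem_union_left _ (RootedJoinTree.mem_freeBelow.2 ⟨hW hx, n, hnt, hn⟩)

variable [Fintype V] [DecidableEq N] [DecidableEq α] {K : List N}

/-- Every partial join is a projection of the solutions, so the single hypothesis `hM` bounds all of
them. -/
theorem processNode_spec (hK : ∀ t, t ∈ K) {s : N} {R : N → Stored V α} {M : ℕ}
    (hs : (R s).Represents (T.bag s) (T.solutions D))
    (hchild : ∀ t, T.IsChild s t → (R t).Represents (T.bag t ∪ T.freeBelow t) (T.solutions D))
    (hR : ∀ t, (R t).rows.length ≤ M)
    (hM : ∀ L (A : Stored V α), A.Represents (T.bag s ∪ T.freeOfChildren s L) (T.solutions D) →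
      A.rows.length ≤ M) :
    (∃ A : Stored V α, (processNode T K s R).val = Function.update R s A ∧
      A.Represents (T.bag s ∪ T.freeBelow s) (T.solutions D) ∧ A.rows.length ≤ M) ∧
    (processNode T K s R).time ≤ K.length * (tupleCost V * (4 * M + 2) + 1) + 2 := by
  classical
  obtain ⟨h1, h2⟩ := loop_invariant_le K (R s)
    (fun t A =>
      if T.IsChild s t then do
        let P ← project (T.freeBelow t ∪ (T.bag s ∩ T.bag t)) (R t)
        join A P
      else return A)
    (fun pre A => A.Represents (T.bag s ∪ T.freeOfChildren s pre) (T.solutions D))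
    (tupleCost V * (4 * M + 2))
    (by rwa [RootedJoinTree.freeOfChildren_nil, Finset.union_empty]) (by
      intro pre t post A hl hA
      by_cases hst : T.IsChild s t
      · simp only [hst, if_true, Timed.bind_val, Timed.bind_time]
        obtain ⟨p1, p2, p3⟩ := (hchild t hst).project
          (X := T.freeBelow t ∪ (T.bag s ∩ T.bag t))
          (by
            rw [Finset.union_comm]
            exact Finset.union_subset_union_left Finset.inter_subset_right)
        obtain ⟨j1, j2⟩ := hA.join p1 (fun v hv w hw hvw =>
          hst.glue_solutions (RootedJoinTree.freeOfChildren_subset s pre) hv hw hvw)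
        have hS : T.bag s ∪ T.freeOfChildren s pre ∪ (T.freeBelow t ∪ (T.bag s ∩ T.bag t)) =
            T.bag s ∪ T.freeOfChildren s (pre ++ [t]) := by
          ext x
          simp only [Finset.mem_union, Finset.mem_inter, RootedJoinTree.mem_freeOfChildren,
            List.mem_append, List.mem_singleton, or_and_right, exists_or, exists_eq_left, hst,
            true_and]
          generalize (∃ t ∈ pre, T.IsChild s t ∧ x ∈ T.freeBelow t) = p
          tauto
        rw [hS] at j1
        refine ⟨j1, ?_⟩
        have a1 := hM _ _ hA
        have a2 := hM _ _ j1
        have a3 := hR t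
        -- The projection handles one relation of at most `M` rows; the join handles three: both
        -- arguments and its result.
        calc _ ≤ tupleCost V * (M + 1) + tupleCost V * (M + M + M + 1) := by
              refine Nat.add_le_add (p3.trans ?_) (j2.trans ?_)
              · exact Nat.mul_le_mul_left _ (by omega)
              · exact Nat.mul_le_mul_left _ (by omega)
          _ = tupleCost V * (4 * M + 2) := by ring
      · simp only [hst, if_false, Timed.pure_val, Timed.pure_time]
        refine ⟨?_, Nat.zero_le _⟩
        have hS : T.freeOfChildren s (pre ++ [t]) = T.freeOfChildren s pre := by
          ext x
          simp [RootedJoinTree.mem_freeOfChildren, or_and_right, exists_or, hst]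
        rwa [hS])
  refine ⟨⟨_, rfl, ?_, hM K _ h1⟩, ?_⟩
  · rwa [RootedJoinTree.bag_union_freeOfChildren hK] at h1
  · exact Nat.add_le_add_right h2 1

theorem process_spec (hK : T.IsLeafToRoot K) {R : N → Stored V α} {M : ℕ}
    (hR : ∀ n, (R n).Represents (T.bag n) (T.solutions D))
    (hM : ∀ s L (A : Stored V α),
      A.Represents (T.bag s ∪ T.freeOfChildren s L) (T.solutions D) → A.rows.length ≤ M) :
    let L := loop K R fun s R => processNode T K s R
    ((L.val T.root).Represents (T.bag T.root ∪ T.freeBelow T.root) (T.solutions D) ∧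
      (L.val T.root).rows.length ≤ M) ∧
    L.time ≤ K.length * (K.length * (tupleCost V * (4 * M + 2) + 1) + 3) + 1 := by
  intro L
  obtain ⟨⟨h1, h2, h3⟩, h4⟩ := loop_invariant_le K R (fun s R => processNode T K s R)
    -- Processed slots hold `T_n`; the others still hold the reduced relations.
    (fun pre R => (∀ n ∈ pre, (R n).Represents (T.bag n ∪ T.freeBelow n) (T.solutions D)) ∧
      (∀ n, n ∉ pre → (R n).Represents (T.bag n) (T.solutions D)) ∧
      ∀ n, (R n).rows.length ≤ M)
    (K.length * (tupleCost V * (4 * M + 2) + 1) + 2)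
    ⟨by simp, fun n _ => hR n, fun n => hM n [] _ (by
      rw [RootedJoinTree.freeOfChildren_nil, Finset.union_empty]
      exact hR n)⟩ (by
      rintro pre s post R hl ⟨h1, h2, h3⟩
      have hs : s ∉ pre := by
        intro hs
        have := hK.nodup
        rw [hl] at this
        exact (List.nodup_append.1 this).2.2 s hs s (by simp) rfl
      obtain ⟨⟨A, e1, e2, e3⟩, e4⟩ := processNode_spec (K := K) hK.mem (h2 s hs)
        (fun t hst => h1 t (hK.child_mem hl hst)) h3 (hM s)
      rw [e1]
      refine ⟨⟨fun n hn => ?_, fun n hn => ?_, fun n => ?_⟩, e4⟩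
      · rw [List.mem_append, List.mem_singleton] at hn
        by_cases hns : n = s
        · subst hns
          rwa [Function.update_self]
        · rw [Function.update_of_ne hns]
          exact h1 n (hn.resolve_right hns)
      · rw [List.mem_append, List.mem_singleton, not_or] at hn
        rw [Function.update_of_ne hn.2]
        exact h2 n hn.1
      · by_cases hns : n = s
        · subst hns
          rwa [Function.update_self]
        · rw [Function.update_of_ne hns]
          exact h3 n)
  exact ⟨⟨h1 _ (hK.mem _), h3 _⟩, h4⟩

/-- A bound on the time of the algorithm on a database of size `d`, if every intermediate result
has at most `M` tuples. -/
def totalCost (V : Type) [Fintype V] (k d M : ℕ) : ℕ :=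
  reducerCost V k d + (k * (k * (tupleCost V * (4 * M + 2) + 1) + 3) + 1) +
    tupleCost V * (M + 1)

theorem yannakakis_spec (hK : T.IsLeafToRoot K) {M : ℕ}
    (hM : ∀ s L (A : Stored V α),
      A.Represents (T.bag s ∪ T.freeOfChildren s L) (T.solutions D) → A.rows.length ≤ M) :
    (yannakakis T K D).val.Represents Q.free (T.solutions D) ∧
    (yannakakis T K D).time ≤ totalCost V K.length D.size M := by
  obtain ⟨h1, h2⟩ := fullReduce_spec (D := D) hK
  obtain ⟨⟨h3, h4⟩, h5⟩ := process_spec hK h1 hM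
  obtain ⟨h6, -, h7⟩ := h3.project (X := Q.free) (by
    intro x hx
    obtain ⟨n, hn⟩ := T.exists_mem_bag x
    exact Finset.mem_union_right _ (RootedJoinTree.mem_freeBelow.2
      ⟨hx, n, RootedJoinTree.inSubtree_root n, hn⟩))
  refine ⟨h6, ?_⟩
  rw [totalCost, add_assoc]
  exact Nat.add_le_add h2 (Nat.add_le_add h5
    (h7.trans (Nat.mul_le_mul_left _ (Nat.add_le_add_right h4 1))))

end Processing

/-! ## Sizes of the intermediate results -/

section Sizes

variable {V : Type} [DecidableEq V] {Q : CQ V} {N : Type} {α : Type} {T : RootedJoinTree Q N}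
  {D : Database Q α}

theorem RootedJoinTree.isIsolated_or_isJoinVar {n : N} {x : V} (hx : x ∈ T.bag n) :
    Q.IsIsolated x ∨ Q.IsJoinVar x := by
  have h : 0 < Q.occ x :=
    Finset.card_pos.2 ⟨T.bag n, Finset.mem_filter.2 ⟨T.bag_mem_edges n, hx⟩⟩
  unfold CQ.IsIsolated CQ.IsJoinVar
  omega

theorem RootedJoinTree.isJoinVar_of_mem_of_mem {n n' : N} (hne : n ≠ n') {x : V}
    (hx : x ∈ T.bag n) (hx' : x ∈ T.bag n') : Q.IsJoinVar x :=
  Finset.one_lt_card.2 ⟨T.bag n, Finset.mem_filter.2 ⟨T.bag_mem_edges n, hx⟩,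
    T.bag n', Finset.mem_filter.2 ⟨T.bag_mem_edges n', hx'⟩, fun h => hne (T.bag_injective h)⟩

theorem RootedJoinTree.mem_joinVars {n : N} {x : V} :
    x ∈ T.joinVars n ↔ x ∈ T.bag n ∧ Q.IsJoinVar x := by
  simp [RootedJoinTree.joinVars]

theorem RootedJoinTree.joinVars_subset (n : N) : T.joinVars n ⊆ T.bag n := by
  classical
  exact Finset.filter_subset _ _

/-- Exchanging the tuple of one node by a tuple of the same relation that agrees with it on the
join variables leads to a solution again. -/
theorem RootedJoinTree.merge_mem_solutions {n : N} {t v : Tup V α}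
    (ht : t ∈ D.rows (T.bag n)) (hv : v ∈ T.solutions D)
    (htv : ∀ x ∈ T.joinVars n, t x = v x) : t.merge v ∈ T.solutions D := by
  have hs := D.schema _ (T.bag_mem_edges n) t ht
  intro m
  by_cases hm : m = n
  · subst hm
    have : (t.merge v).restrict (T.bag m) = t := by
      rw [← hs.restrict_eq, Tup.restrict_eq_iff]
      intro x hx
      obtain ⟨a, ha⟩ := Option.isSome_iff_exists.1 ((hs x).2 hx)
      simp [Tup.merge, hs.restrict_eq, ha]
    rwa [this]
  · have : (t.merge v).restrict (T.bag m) = v.restrict (T.bag m) := by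
      rw [Tup.restrict_eq_iff]
      intro x hx
      by_cases hxn : x ∈ T.bag n
      · have := htv x (RootedJoinTree.mem_joinVars.2
          ⟨hxn, RootedJoinTree.isJoinVar_of_mem_of_mem hm hx hxn⟩)
        simp [Tup.merge, this]
      · have h1 : t x = none := by simpa using fun h' => hxn ((hs x).1 h')
        simp [Tup.merge, h1]
    rw [this]
    exact hv m

/-- If the root relation has large degrees, then every solution restricted to free variables that
are not isolated variables of the root bag extends to many results. -/
theorem RootedJoinTree.mul_card_le_card_output (hQ : Q.IsReduced) {Δ : ℕ}
    (hΔ : ∀ v ∈ D.rows (T.bag T.root), Δ < D.degree v (T.joinVars T.root) (T.bag T.root))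
    {W : Finset V} (hWf : W ⊆ Q.free) (hWr : ∀ x ∈ W, x ∈ T.bag T.root → Q.IsJoinVar x)
    {P O : Finset (Tup V α)} (hP : ∀ k ∈ P, ∃ v ∈ T.solutions D, v.restrict W = k)
    (hO : ∀ v ∈ T.solutions D, v.restrict Q.free ∈ O) :
    Δ * P.card ≤ O.card := by
  classical
  -- Double counting: the outputs are sorted by their `W`-part, and each class over `P` is shown to
  -- have at least `Δ` members.
  refine le_trans ?_ (Finset.card_le_card
    (Finset.filter_subset (fun o : Tup V α => o.restrict W ∈ P) O))
  refine Finset.mul_card_image_le_card_of_maps_to (f := fun o : Tup V α => o.restrict W)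
    (fun o ho => (Finset.mem_filter.1 ho).2) Δ (fun k hk => ?_)
  obtain ⟨v, hv, rfl⟩ := hP k hk
  have hdeg := hΔ _ (hv T.root)
  rw [Database.degree, ← List.toFinset_card_of_nodup
    ((D.nodup _ (T.bag_mem_edges T.root)).filter _)] at hdeg
  -- Root tuples agreeing with `v` on the join variables are mapped to the outputs obtained by
  -- putting them in place of the root tuple of `v`.
  refine hdeg.le.trans (Finset.card_le_card_of_injOn
    (fun t : Tup V α => (t.merge v).restrict Q.free) ?_ ?_)
  all_goals
    have agree : ∀ t ∈ (((D.rows (T.bag T.root)).filter (fun t =>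
        decide (t.restrict (T.joinVars T.root) =
          (v.restrict (T.bag T.root)).restrict (T.joinVars T.root)))).toFinset),
        t ∈ D.rows (T.bag T.root) ∧ ∀ x ∈ T.joinVars T.root, t x = v x := by
      intro t ht
      rw [List.mem_toFinset, List.mem_filter, decide_eq_true_iff,
        Tup.restrict_restrict_of_subset _ (RootedJoinTree.joinVars_subset _), Tup.restrict_eq_iff] at ht
      exact ht
  · intro t ht
    obtain ⟨h1, h2⟩ := agree t ht
    have hW : ((t.merge v).restrict Q.free).restrict W = v.restrict W := by
      rw [Tup.restrict_restrict_of_subset _ hWf, Tup.restrict_eq_iff]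
      intro x hx
      by_cases hxr : x ∈ T.bag T.root
      · simp [Tup.merge, h2 x (RootedJoinTree.mem_joinVars.2 ⟨hxr, hWr x hx hxr⟩)]
      · have h3 : t x = none := by
          simpa using fun h' => hxr ((D.schema _ (T.bag_mem_edges T.root) t h1 x).1 h')
        simp [Tup.merge, h3]
    simp only [Finset.coe_filter, Set.mem_ofPred_eq, Finset.mem_filter]
    exact ⟨⟨hO _ (RootedJoinTree.merge_mem_solutions h1 hv h2), by rwa [hW]⟩, hW⟩
  · intro t ht t' ht' he
    obtain ⟨h1, h2⟩ := agree t ht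
    obtain ⟨h1', h2'⟩ := agree t' ht'
    have s := D.schema _ (T.bag_mem_edges T.root) t h1
    have s' := D.schema _ (T.bag_mem_edges T.root) t' h1'
    rw [← s.restrict_eq, ← s'.restrict_eq, Tup.restrict_eq_iff]
    intro x hx
    -- Isolated variables are free and can be read off the output; join variables are fixed by `v`.
    rcases RootedJoinTree.isIsolated_or_isJoinVar hx with hi | hj
    · have := (Tup.restrict_eq_iff _ _ _).1 he x (hQ.isolated_free x hi)
      obtain ⟨a, ha⟩ := Option.isSome_iff_exists.1 ((s x).2 hx)
      obtain ⟨a', ha'⟩ := Option.isSome_iff_exists.1 ((s' x).2 hx)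
      simpa [Tup.merge, ha, ha'] using this
    · have hx' := RootedJoinTree.mem_joinVars.2 ⟨hx, hj⟩
      rw [h2 x hx', h2' x hx']

/-- The root is not below any child, so such a variable lies in two different bags. -/
theorem RootedJoinTree.isJoinVar_of_mem_freeOfChildren {s : N} {L : List N} {x : V}
    (hx : x ∈ T.freeOfChildren s L) (hr : x ∈ T.bag T.root) : Q.IsJoinVar x := by
  obtain ⟨t, -, hst, hxt⟩ := RootedJoinTree.mem_freeOfChildren.1 hx
  obtain ⟨-, n, hn, hxn⟩ := RootedJoinTree.mem_freeBelow.1 hxt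
  exact RootedJoinTree.isJoinVar_of_mem_of_mem
    (by rintro rfl; exact hst.not_inSubtree_root hn) hxn hr

theorem Stored.Represents.length_mul_le (hQ : Q.IsReduced) {Δ : ℕ}
    (hΔ : ∀ v ∈ D.rows (T.bag T.root), Δ < D.degree v (T.joinVars T.root) (T.bag T.root))
    {O : Finset (Tup V α)} (hO : ∀ v ∈ T.solutions D, v.restrict Q.free ∈ O) {s : N}
    {L : List N} {A : Stored V α}
    (hA : A.Represents (T.bag s ∪ T.freeOfChildren s L) (T.solutions D)) :
    A.rows.length * Δ ≤ (D.rows (T.bag s)).length * O.card := by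
  classical
  have hP := RootedJoinTree.mul_card_le_card_output hQ hΔ
    (RootedJoinTree.freeOfChildren_subset s L)
    (fun x hx hr => RootedJoinTree.isJoinVar_of_mem_freeOfChildren hx hr)
    (P := A.rows.toFinset.image (fun k => k.restrict (T.freeOfChildren s L))) (by
      intro k hk
      obtain ⟨u, hu, rfl⟩ := Finset.mem_image.1 hk
      obtain ⟨v, hv, rfl⟩ := (hA.mem_iff u).1 (List.mem_toFinset.1 hu)
      exact ⟨v, hv, (Tup.restrict_restrict_of_subset v Finset.subset_union_right).symm⟩) hO
  -- A row is recovered from its part on `bag s` and its part on the free variables below, although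
  -- the two may overlap.
  have hcard : A.rows.toFinset.card ≤ ((D.rows (T.bag s)).toFinset ×ˢ
      A.rows.toFinset.image (fun k => k.restrict (T.freeOfChildren s L))).card := by
    refine Finset.card_le_card_of_injOn
      (fun k => (k.restrict (T.bag s), k.restrict (T.freeOfChildren s L))) ?_ ?_
    · intro k hk
      have hk := Finset.mem_coe.1 hk
      refine Finset.mem_coe.2 (Finset.mem_product.2 ⟨?_, Finset.mem_image_of_mem _ hk⟩)
      obtain ⟨v, hv, rfl⟩ := (hA.mem_iff k).1 (List.mem_toFinset.1 hk)
      rw [List.mem_toFinset]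
      simp only [Tup.restrict_restrict_of_subset v Finset.subset_union_left]
      exact hv s
    · intro k hk k' hk' he
      obtain ⟨v, hv, rfl⟩ := (hA.mem_iff k).1 (List.mem_toFinset.1 hk)
      obtain ⟨v', hv', rfl⟩ := (hA.mem_iff k').1 (List.mem_toFinset.1 hk')
      simp only [Tup.restrict_restrict_of_subset _ Finset.subset_union_left,
        Tup.restrict_restrict_of_subset _ Finset.subset_union_right, Prod.mk.injEq] at he
      rw [← Tup.merge_restrict, ← Tup.merge_restrict, he.1, he.2]
  rw [List.toFinset_card_of_nodup hA.nodup, Finset.card_product,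
    List.toFinset_card_of_nodup (D.nodup _ (T.bag_mem_edges s))] at hcard
  calc A.rows.length * Δ
      ≤ (D.rows (T.bag s)).length *
        (A.rows.toFinset.image (fun k => k.restrict (T.freeOfChildren s L))).card * Δ :=
        Nat.mul_le_mul_right _ hcard
    _ = (D.rows (T.bag s)).length *
        (Δ * (A.rows.toFinset.image (fun k => k.restrict (T.freeOfChildren s L))).card) := by ring
    _ ≤ _ := Nat.mul_le_mul_left _ hP

theorem RootedJoinTree.finite_solutions [Finite N] : (T.solutions D).Finite := by
  refine Set.Finite.of_injOn (f := fun v n => v.restrict (T.bag n))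
    (t := Set.pi Set.univ fun n => {t | t ∈ D.rows (T.bag n)}) (fun v hv n _ => hv n) ?_
    (Set.Finite.pi fun n => List.finite_toSet _)
  intro v _ w _ he
  funext x
  obtain ⟨n, hn⟩ := T.exists_mem_bag x
  exact (Tup.restrict_eq_iff _ _ _).1 (congrFun he n) x hn

theorem RootedJoinTree.output_eq (T : RootedJoinTree Q N) (D : Database Q α) :
    D.output = {t | ∃ v ∈ T.solutions D, v.restrict Q.free = t} := by
  ext t
  constructor
  · rintro ⟨v, hv, rfl⟩
    exact ⟨fun x => some (v x), fun n => hv _ (T.bag_mem_edges n), rfl⟩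
  · rintro ⟨v, hv, rfl⟩
    -- Every variable occurs in a bag, so a solution is defined everywhere and is a valuation.
    have hsome : ∀ x, (v x).isSome := by
      intro x
      obtain ⟨n, hn⟩ := T.exists_mem_bag x
      have := (D.schema _ (T.bag_mem_edges n) _ (hv n) x).2 hn
      simpa [Tup.restrict_apply, hn] using this
    have hv' : ∀ J, tupleOf (fun x => (v x).get (hsome x)) J = v.restrict J := by
      intro J
      funext x
      simp [tupleOf, Tup.restrict_apply]
    refine ⟨fun x => (v x).get (hsome x), fun J hJ => ?_, (hv' _).symm⟩
    obtain ⟨n, rfl⟩ := (T.mem_edges_iff J).1 hJ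
    rw [hv']
    exact hv n

theorem RootedJoinTree.IsLeafToRoot.length_le_card_edges {K : List N} (hK : T.IsLeafToRoot K) :
    K.length ≤ Q.edges.card := by
  rw [← List.length_map T.bag, ← List.toFinset_card_of_nodup (hK.nodup.map T.bag_injective)]
  refine Finset.card_le_card fun J hJ => ?_
  rw [List.mem_toFinset, List.mem_map] at hJ
  obtain ⟨n, -, rfl⟩ := hJ
  exact T.bag_mem_edges n

/-- The cost is affine in `d` and `M`, so with `d ≤ M` each term is at most its value at `d = M = 1`
times `M + 1`. -/
theorem totalCost_le (V : Type) [Fintype V] {k k' d M : ℕ} (hk : k ≤ k') (hd : d ≤ M) :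
    totalCost V k d M ≤ totalCost V k' 1 1 * (M + 1) := by
  have key : ∀ {x c : ℕ} (a : ℕ), x ≤ c * (M + 1) → k * x + a ≤ (k' * c + a) * (M + 1) := by
    intro x c a hx
    have := Nat.mul_le_mul hk hx
    nlinarith [Nat.zero_le (a * M)]
  have h1 : tupleCost V * (2 * d + 1) + 2 ≤ (tupleCost V * (2 * 1 + 1) + 2) * (M + 1) := by
    have := Nat.mul_le_mul_left (tupleCost V) hd
    nlinarith
  have h2 : tupleCost V * (4 * M + 2) + 1 ≤ (tupleCost V * (4 * 1 + 2) + 1) * (M + 1) := by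
    nlinarith [Nat.zero_le (tupleCost V * M)]
  have h3 := key 1 (key 2 h1)
  have h4 := key 1 (key 3 h2)
  have h5 : tupleCost V * (M + 1) ≤ tupleCost V * (1 + 1) * (M + 1) := by
    nlinarith [Nat.zero_le (tupleCost V * M)]
  unfold totalCost reducerCost
  linarith

end Sizes

end OSY

/-! ### The size bound and the constant -/

open Classical in
theorem mainTheorem3 {V : Type} [Fintype V] [DecidableEq V] (Q : OSY.CQ V) (hQ : Q.IsReduced) :
    ∃ C : ℝ, 0 < C ∧
      ∀ (N : Type) [Fintype N] [DecidableEq N] (α : Type) [DecidableEq α]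
        (T : OSY.RootedJoinTree Q N) (K : List N), T.IsLeafToRoot K →
      ∀ (D : OSY.Database Q α) (Δ : ℕ), 1 ≤ Δ →
        (∃ x ∈ T.bag T.root, x ∈ Q.free ∧ Q.IsIsolated x) →
        (∀ v ∈ D.rows (T.bag T.root), Δ < D.degree v (T.joinVars T.root) (T.bag T.root)) →
        ((OSY.yannakakis T K D).val.rows.Nodup ∧
          {t | t ∈ (OSY.yannakakis T K D).val.rows} = D.output) ∧
        (0 < D.size →
          ((OSY.yannakakis T K D).time : ℝ) ≤
            C * ((D.size : ℝ) +
              (∑ t ∈ Finset.univ.filter (fun t => T.IsInternal t),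
                ((D.rows (T.bag t)).length : ℝ)) * (D.output.ncard : ℝ) / (Δ : ℝ))) := by
  refine ⟨2 * OSY.totalCost V Q.edges.card 1 1 + 1, by positivity, ?_⟩
  intro N _ _ α _ T K hK D Δ hΔ _ hdeg
  have hfin : D.output.Finite := by
    rw [T.output_eq D]
    exact (OSY.RootedJoinTree.finite_solutions (T := T) (D := D)).image fun v =>
      OSY.Tup.restrict v Q.free
  set I : ℕ := ∑ t ∈ Finset.univ.filter (fun t => T.IsInternal t), (D.rows (T.bag t)).length
    with hI
  -- The first summand covers the leaves, the second the internal nodes. Rounding down is harmless,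
  -- since row counts are integers.
  set M : ℕ := D.size + I * D.output.ncard / Δ with hMdef
  have hM : ∀ s L (A : OSY.Stored V α),
      A.Represents (T.bag s ∪ T.freeOfChildren s L) (T.solutions D) → A.rows.length ≤ M := by
    intro s L A hA
    by_cases hs : T.IsInternal s
    · have h1 := hA.length_mul_le hQ hdeg (O := hfin.toFinset) (fun v hv => by
        rw [Set.Finite.mem_toFinset, T.output_eq D]
        exact ⟨v, hv, rfl⟩)
      rw [← Set.ncard_eq_toFinset_card _ hfin] at h1
      have h2 : (D.rows (T.bag s)).length ≤ I :=
        Finset.single_le_sum (f := fun t => (D.rows (T.bag t)).length)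
          (fun _ _ => Nat.zero_le _) (Finset.mem_filter.2 ⟨Finset.mem_univ s, hs⟩)
      exact le_add_left ((Nat.le_div_iff_mul_le hΔ).2 (h1.trans (Nat.mul_le_mul_right _ h2)))
    · have hW : T.freeOfChildren s L = ∅ := by
        ext x
        simp only [OSY.RootedJoinTree.mem_freeOfChildren, Finset.notMem_empty, iff_false]
        rintro ⟨t, -, hst, -⟩
        exact hs ⟨t, hst⟩
      rw [hW, Finset.union_empty] at hA
      have h1 : A.rows.length ≤ (D.rows (T.bag s)).length :=
        (hA.nodup.subperm fun u hu => by
          obtain ⟨v, hv, rfl⟩ := (hA.mem_iff u).1 hu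
          exact hv s).length_le
      exact le_add_right (h1.trans (D.length_rows_le_size (T.bag_mem_edges s)))
  obtain ⟨h1, h2⟩ := OSY.yannakakis_spec (D := D) hK hM
  refine ⟨⟨h1.nodup, ?_⟩, fun hD => ?_⟩
  · rw [T.output_eq D]
    ext t
    exact h1.mem_iff t
  · have h3 := h2.trans (OSY.totalCost_le V hK.length_le_card_edges (Nat.le_add_right _ _ : _ ≤ M))
    have h4 : (M : ℝ) ≤ D.size + I * D.output.ncard / Δ := by
      rw [hMdef, Nat.cast_add]
      refine add_le_add le_rfl (Nat.cast_div_le.trans (le_of_eq ?_))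
      rw [Nat.cast_mul]
    -- A non-empty database absorbs the additive constant; this is the factor `2` in the final
    -- constant, whose `+ 1` only ensures positivity.
    have h5 : M + 1 ≤ 2 * M := by
      have : 1 ≤ M := le_add_right hD
      omega
    rw [← Nat.cast_sum, ← hI]
    calc ((OSY.yannakakis T K D).time : ℝ)
        ≤ ((OSY.totalCost V Q.edges.card 1 1 * (2 * M) : ℕ) : ℝ) :=
          Nat.cast_le.2 (h3.trans (Nat.mul_le_mul_left _ h5))
      _ = 2 * OSY.totalCost V Q.edges.card 1 1 * M := by push_cast; ring
      _ ≤ (2 * OSY.totalCost V Q.edges.card 1 1 + 1) * M :=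
          mul_le_mul_of_nonneg_right (by linarith) (Nat.cast_nonneg M)
      _ ≤ _ := mul_le_mul_of_nonneg_left h4 (by positivity)
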